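/- Let $d\ge 1$, $1<p<\infty$ with Hölder conjugate $p'=p/(p-1)$, and $\sigma>0$. For $T\ge 2$ let $(\mathbb{R}^d)^T$ carry the Euclidean norm $|\cdot|$; for $x\in(\mathbb{R}^d)^T$ and $1\le t\le T$ write $x_{1:t}=(x_1,\dots,x_t)$, and for a Borel probability measure $\mu$ on $(\mathbb{R}^d)^T$ let $\mu_{1:t}$ be the image of $\mu$ under $x\mapsto x_{1:t}$, let $\operatorname{mean}(\mu_{1:t})=\int u\,\mu_{1:t}(du)$, and let $\mathcal{E}_r(\mu)=\int e^{r|x|^2}\mu(dx)$. Let $\mu^\sigma=\mu*\mathcal{N}(0,\sigma^2 I_{dT})$. For $1\le t\le T-1$ and $u\in(\mathbb{R}^d)^t$ let $(\mu^\sigma)_u$ be the measure on $\mathbb{R}^d$ with Lebesgue density $$z\mapsto \frac{\int \varphi_\sigma(u-w_{1:t})\,\varphi_\sigma(z-w_{t+1})\,\mu(dw)}{\int \varphi_\sigma(u-w_{1:t})\,\mu(dw)},\qquad \varphi_\sigma(v)=(2\pi\sigma^2)^{-n/2}e^{-|v|^2/(2\sigma^2)}\ \text{ for } v\in\mathbb{R}^n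 .$$ Let $\mathcal{W}_p$ denote the $p$-Wasserstein distance on $\mathbb{R}^d$ with respect to $|\cdot|$. (i) For every $T\ge2$, every Borel probability measure $\mu$ on $(\mathbb{R}^d)^T$ and every $t\in\{1,\dots,T-1\}$, $u\mapsto(\mu^\sigma)_u$ is a regular conditional distribution of $X_{t+1}$ given $X_{1:t}=u$ for $X\sim\mu^\sigma$. (ii) Let $0<\beta<1/p'$ and $q>2(p-1)/\beta$. For every $M<\infty$ there is a constant $C>0$, depending only on $d,p,\sigma,q,\beta,M$, such that for all $T\ge 2$, all Borel probability measures $\mu$ on $(\mathbb{R}^d)^T$ with $\mathcal{E}_{q/(2\sigma^2)}(\mu)=M$, all $x,y\in(\mathbb{R}^d)^T$ and all $t\in\{1,\dots,T-1\}$, $$\mathcal{W}_p\big((\mu^\sigma)_{x_{1:t}},(\mu^\sigma)_{y_{1:t}}\big)\le C\exp\Big(\frac{\beta}{\sigma^2}\max\big(|x_{1:t}-\operatorname{mean}(\mu_{1:t})|,|y_{1:t}-\operatorname{mean}(\mu_{1:t})|\big)^2\Big)\,|x_{1:t}-y_{1:t}| .$$ (iii) For every $T\ge2$ and every compact $S\subset(\mathbb{R}^d)^T$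 there is a constant $C>0$, depending only on $d,p,\sigma,S$, such that for all Borel probability measures $\mu$ on $(\mathbb{R}^d)^T$ with $\operatorname{supp}(\mu)=S$, all $x,y\in(\mathbb{R}^d)^T$ and all $t\in\{1,\dots,T-1\}$, $$\mathcal{W}_p\big((\mu^\sigma)_{x_{1:t}},(\mu^\sigma)_{y_{1:t}}\big)\le C\,|x_{1:t}-y_{1:t}| .$$ -/

import Mathlib

open MeasureTheory ProbabilityTheory
open scoped ENNReal

noncomputable section

/-- The state space `ℝ^d` with the Euclidean norm. -/
abbrev St (d : ℕ) : Type := EuclideanSpace ℝ (Fin d)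

/-- The path space `(ℝ^d)^T` with the `ℓ²` (Euclidean) norm. -/
abbrev PathSp (d T : ℕ) : Type := PiLp 2 (fun _ : Fin T => St d)

/-- `x_{1:t} = (x_1, …, x_t)`, the first `t` time steps of the path `x`. -/
def initSeg {d T : ℕ} (t : ℕ) (ht : t ≤ T) (x : PathSp d T) : PathSp d t :=
  WithLp.toLp 2 fun i : Fin t => x (Fin.castLE ht i)

/-- `x_{t+1}`, the state of the path `x` at time `t + 1`; times `1, …, T` are the indices
`0, …, T - 1` of `Fin T`. -/
def nextState {d T : ℕ} (t : ℕ) (ht : t < T) (x : PathSp d T) : St d := x ⟨t, ht⟩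

/-- The exponential moment `∫ exp(r |x|²) μ(dx) ∈ [0, ∞]`. -/
def expMoment {E : Type*} [NormedAddCommGroup E] [MeasurableSpace E] (r : ℝ) (μ : Measure E) :
    ℝ≥0∞ :=
  ∫⁻ x, ENNReal.ofReal (Real.exp (r * ‖x‖ ^ 2)) ∂μ

/-- The mean `∫ x μ(dx)`. -/
def meanOf {E : Type*} [NormedAddCommGroup E] [NormedSpace ℝ E] [MeasurableSpace E]
    (μ : Measure E) : E :=
  ∫ x, x ∂μ

/-- The `p`-Wasserstein distance, with values in `[0, ∞]`: the infimum over all couplings `π` of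
`(∫ |x - y|^p π(dx, dy))^(1/p)`. -/
def wasserstein {E : Type*} [PseudoEMetricSpace E] [MeasurableSpace E] (p : ℝ)
    (μ ν : Measure E) : ℝ≥0∞ :=
  (⨅ π ∈ {π : Measure (E × E) | π.map Prod.fst = μ ∧ π.map Prod.snd = ν},
    ∫⁻ z, edist z.1 z.2 ^ p ∂π) ^ (1 / p)

/-- The centred Gaussian measure with covariance `σ² I` on the path space. -/
def gaussianNoise (d T : ℕ) (σ : ℝ) : Measure (PathSp d T) :=
  (stdGaussian (PathSp d T)).map (fun x => σ • x)

/-- The smoothed measure `μ^σ = μ ∗ 𝒩_σ`. -/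
def smoothed {d T : ℕ} (σ : ℝ) (μ : Measure (PathSp d T)) : Measure (PathSp d T) :=
  Measure.conv μ (gaussianNoise d T σ)

/-- The density `(2πσ²)^(-n/2) exp(-|v|²/(2σ²))` of the centred Gaussian measure with covariance
`σ² I` on the Euclidean space `E` of dimension `n`. -/
def gaussDensity {E : Type*} [NormedAddCommGroup E] [NormedSpace ℝ E] (σ : ℝ) (v : E) : ℝ :=
  (2 * Real.pi * σ ^ 2) ^ (-(Module.finrank ℝ E : ℝ) / 2) * Real.exp (-‖v‖ ^ 2 / (2 * σ ^ 2))

/-- The density of the law of the first `t` time steps under `μ^σ`, at the point `u`. -/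
def initialDensity {d T : ℕ} (σ : ℝ) (μ : Measure (PathSp d T)) (t : ℕ) (ht : t < T)
    (u : PathSp d t) : ℝ≥0∞ :=
  ∫⁻ w, ENNReal.ofReal (gaussDensity σ (u - initSeg t ht.le w)) ∂μ

/-- The density of the law of the first `t + 1` time steps under `μ^σ`, at the point `(u, z)`;
the Gaussian density on `(ℝ^d)^(t+1)` is the product of those on `(ℝ^d)^t` and `ℝ^d`. -/
def jointDensity {d T : ℕ} (σ : ℝ) (μ : Measure (PathSp d T)) (t : ℕ) (ht : t < T)
    (u : PathSp d t) (z : St d) : ℝ≥0∞ :=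
  ∫⁻ w, ENNReal.ofReal (gaussDensity σ (u - initSeg t ht.le w) * gaussDensity σ (z - nextState t ht w))
    ∂μ

/-- The conditional kernel `(μ^σ)_{x_{1:t}}`: the conditional law of `X_{t+1}` given
`X_{1:t} = u`, for `X ∼ μ^σ`, in its continuous version, which is defined at every point `u` by
the quotient of the (continuous, positive) densities. -/
def smoothedKernel {d T : ℕ} (σ : ℝ) (μ : Measure (PathSp d T)) (t : ℕ) (ht : t < T)
    (u : PathSp d t) : Measure (St d) :=
  (volume : Measure (St d)).withDensity
    fun z => jointDensity σ μ t ht u z / initialDensity σ μ t ht u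

end

/-! ### Isotropic Gaussian measures: explicit density and characteristic function. -/

section Gaussian

/-! The kernel at u is a mixture of Gaussians N(w_{t+1}, σ²I) over paths w with weight f_u(w)
(`tiltWeight`), where f_u(w) is proportional to exp(-|u - w_{1:t}|²/(2σ²)). That it is a conditional
law follows from Tonelli, because the noise on x_{1:t} and on x_{t+1} is independent.

To compare the kernels at u and v, take pairs (w, w') with weight F = f_u(w) f_v(w') under μ ⊗ μ.
Exchanging u and v gives F' = F exp(-⟨u - v, w_{1:t} - w'_{1:t}⟩/σ²). With b = w_{t+1} and b' =
w'_{t+1}, symmetrising min(F, F') shows that both kernels contain the background min(F, F')/2 ·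
(N(b) + N(b')). They differ only in an extra mass D = (F - F')⁺, placed at b for u and at b' for v,
and D is of first order in |u - v|.

Moving D straight from b to b' costs D|b - b'|^p, which yields only a Hölder bound of order 1/p.
Instead, the background dominates a uniform chain of Gaussians along the segment from b' to b, of
total mass c = min(F, F')/2 · exp(-|b - b'|²/(8σ²)) (`gaussDensity_segment_le`). Pushing the whole
chain by D moves every piece by at most min(1, D/c)|b - b'| (`wasserstein_le_of_background`), at a
cost of order D^p c^(1-p) (`transport_cost_le`). Hence W_p^p is at most a constant times |u - v|^p ∫
F |w - w'|^(2p) exp((p-1)|w - w'|²/(8σ²)) (`wasserstein_smoothedKernel_le`).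

For bounded support the cost factor is bounded and F has total mass 1. For subgaussian μ, Jensen's
inequality bounds the normalising constant of f_u from below, and interpolation with exponent θ =
(p-1)/q limits the growth to exp(θR²/(pσ²)) after the p-th root, R being the larger distance to the
mean. All constants involve only p, σ, q and M, so they are uniform in T. -/

lemma gaussDensity_pos {E : Type*} [NormedAddCommGroup E] [InnerProductSpace ℝ E]
    {σ : ℝ} (hσ : 0 < σ) (v : E) : 0 < gaussDensity σ v := by
  unfold gaussDensity; positivity

lemma continuous_gaussDensity {E : Type*} [NormedAddCommGroup E] [InnerProductSpace ℝ E] (σ : ℝ) :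
    Continuous (gaussDensity σ : E → ℝ) := by
  unfold gaussDensity; fun_prop

variable {E : Type*} [NormedAddCommGroup E] [InnerProductSpace ℝ E] [FiniteDimensional ℝ E]
  [MeasurableSpace E] [BorelSpace E]

/-- The centred Gaussian measure with covariance `σ² I`, given by its density. -/
noncomputable def gaussMeasure (E : Type*) [NormedAddCommGroup E] [InnerProductSpace ℝ E]
    [FiniteDimensional ℝ E] [MeasurableSpace E] [BorelSpace E] (σ : ℝ) : Measure E :=
  volume.withDensity fun v => ENNReal.ofReal (gaussDensity σ v)

lemma gaussDensity_integrable {σ : ℝ} (hσ : 0 < σ) : Integrable (gaussDensity σ : E → ℝ) := by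
  have h := (GaussianFourier.integrable_cexp_neg_mul_sq_norm_add (V := E)
    (b := ((1 / (2 * σ ^ 2) : ℝ) : ℂ)) (by rw [Complex.ofReal_re]; positivity) 0 0).re
  refine (h.const_mul ((2 * Real.pi * σ ^ 2) ^ (-(Module.finrank ℝ E : ℝ) / 2))).congr
    (ae_of_all _ fun v => ?_)
  simp only [gaussDensity]
  congr 1
  rw [← Complex.exp_ofReal_re]
  simp only [RCLike.re_eq_complex_re]
  congr 2
  push_cast
  simp
  ring

lemma charFun_gaussMeasure {σ : ℝ} (hσ : 0 < σ) (t : E) :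
    charFun (gaussMeasure E σ) t = Complex.exp (-(σ ^ 2 * ‖t‖ ^ 2) / 2) := by
  have hb : 0 < (((1 / (2 * σ ^ 2) : ℝ) : ℂ)).re := by rw [Complex.ofReal_re]; positivity
  have h := GaussianFourier.integral_cexp_neg_mul_sq_norm_add (V := E) hb Complex.I t
  rw [charFun_apply, gaussMeasure, integral_withDensity_eq_integral_toReal_smul₀
    ((continuous_gaussDensity σ).measurable.ennreal_ofReal.aemeasurable)
    (ae_of_all _ fun _ => ENNReal.ofReal_lt_top)]
  set k : ℝ := (2 * Real.pi * σ ^ 2) ^ (-(Module.finrank ℝ E : ℝ) / 2) with hk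
  have e1 : ∀ x : E, (ENNReal.ofReal (gaussDensity σ x)).toReal • Complex.exp (inner ℝ x t * Complex.I)
      = (k : ℂ) * Complex.exp (-((1 / (2 * σ ^ 2) : ℝ) : ℂ) * ‖x‖ ^ 2 + Complex.I * inner ℝ t x) := by
    intro x
    rw [ENNReal.toReal_ofReal (gaussDensity_pos hσ x).le, gaussDensity, ← hk, Complex.exp_add,
      Complex.real_smul]
    push_cast
    rw [real_inner_comm, mul_assoc, mul_comm Complex.I]
    congr 3
    ring
  simp_rw [e1]
  rw [integral_const_mul, h]
  have h2 : (k : ℂ) * (Real.pi / ((1 / (2 * σ ^ 2) : ℝ) : ℂ)) ^ (Module.finrank ℝ E / 2 : ℂ) = 1 := by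
    have : (Real.pi / ((1 / (2 * σ ^ 2) : ℝ) : ℂ)) = ((2 * Real.pi * σ ^ 2 : ℝ) : ℂ) := by
      push_cast; field_simp
    rw [this]
    have e : (Module.finrank ℝ E / 2 : ℂ) = (((Module.finrank ℝ E : ℝ) / 2 : ℝ) : ℂ) := by push_cast; rfl
    rw [e, ← Complex.ofReal_cpow (by positivity), ← Complex.ofReal_mul, hk, neg_div,
      Real.rpow_neg (by positivity), inv_mul_cancel₀ (by positivity)]
    simp
  rw [← mul_assoc, h2, one_mul]
  congr 1
  have : (σ : ℂ) ≠ 0 := by exact_mod_cast hσ.ne'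
  push_cast
  rw [Complex.I_sq]
  field_simp
  ring

lemma isFiniteMeasure_gaussMeasure {σ : ℝ} (hσ : 0 < σ) : IsFiniteMeasure (gaussMeasure E σ) :=
  isFiniteMeasure_withDensity_ofReal (gaussDensity_integrable hσ).2

/-- Equality of characteristic functions; it links the density used in the kernel with the noise
defined through `stdGaussian`. -/
lemma gaussMeasure_eq {σ : ℝ} (hσ : 0 < σ) :
    gaussMeasure E σ = (stdGaussian E).map (fun x => σ • x) := by
  have := isFiniteMeasure_gaussMeasure (E := E) hσ
  refine Measure.ext_of_charFun (funext fun t => ?_)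
  rw [charFun_gaussMeasure hσ, charFun_map_smul, charFun_stdGaussian, norm_smul]
  congr 1
  rw [Real.norm_eq_abs, abs_of_pos hσ]
  push_cast; ring

lemma isProbabilityMeasure_gaussMeasure {σ : ℝ} (hσ : 0 < σ) :
    IsProbabilityMeasure (gaussMeasure E σ) := by
  rw [gaussMeasure_eq hσ]
  exact Measure.isProbabilityMeasure_map (by fun_prop)

lemma lintegral_gaussMeasure (σ : ℝ) {h : E → ℝ≥0∞} (hh : Measurable h) :
    ∫⁻ z, h z ∂gaussMeasure E σ = ∫⁻ z, ENNReal.ofReal (gaussDensity σ z) * h z := by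
  rw [gaussMeasure, lintegral_withDensity_eq_lintegral_mul _
    (continuous_gaussDensity σ).measurable.ennreal_ofReal hh]
  rfl

lemma lintegral_gaussMeasure_add (σ : ℝ) {h : E → ℝ≥0∞} (hh : Measurable h) (b : E) :
    ∫⁻ z, h (b + z) ∂gaussMeasure E σ = ∫⁻ z, ENNReal.ofReal (gaussDensity σ (z - b)) * h z := by
  rw [lintegral_gaussMeasure σ (by fun_prop),
    ← lintegral_add_left_eq_self (fun z => ENNReal.ofReal (gaussDensity σ (z - b)) * h z) b]
  simp

end Gaussian

/-! ### Splitting a path, and Gaussian noise on it, into past and next state. -/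

section Paths

variable {d T : ℕ}

lemma continuous_initSeg (t : ℕ) (ht : t ≤ T) : Continuous (initSeg (d := d) t ht) := by
  unfold initSeg; fun_prop

lemma continuous_nextState (t : ℕ) (ht : t < T) : Continuous (nextState (d := d) t ht) := by
  unfold nextState; fun_prop

lemma measurable_initSeg (t : ℕ) (ht : t ≤ T) : Measurable (initSeg (d := d) t ht) :=
  (continuous_initSeg t ht).measurable

lemma measurable_nextState (t : ℕ) (ht : t < T) : Measurable (nextState (d := d) t ht) :=
  (continuous_nextState t ht).measurable

/-- The path which starts with `u`, continues with `z` and vanishes afterwards. -/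
def extendPath (t : ℕ) (u : PathSp d t) (z : St d) : PathSp d T :=
  WithLp.toLp 2 fun i : Fin T => if h : (i : ℕ) < t then u ⟨i, h⟩ else if (i : ℕ) = t then z else 0

lemma initSeg_extendPath (t : ℕ) (ht : t ≤ T) (u : PathSp d t) (z : St d) :
    initSeg t ht (extendPath t u z : PathSp d T) = u := by
  ext i j
  simp [initSeg, extendPath]

lemma nextState_extendPath (t : ℕ) (ht : t < T) (u : PathSp d t) (z : St d) :
    nextState t ht (extendPath t u z : PathSp d T) = z := by
  simp [nextState, extendPath]

/-- `extendPath` is the adjoint of x ↦ (x_{1:t}, x_{t+1}); this gives both the norm bounds and the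
characteristic function of the image measure. -/
lemma inner_extendPath (t : ℕ) (ht : t < T) (x : PathSp d T) (u : PathSp d t) (z : St d) :
    inner ℝ x (extendPath t u z) = inner ℝ (initSeg t ht.le x) u + inner ℝ (nextState t ht x) z := by
  obtain ⟨k, rfl⟩ : ∃ k, T = t + (1 + k) := ⟨T - t - 1, by omega⟩
  rw [PiLp.inner_apply, PiLp.inner_apply (initSeg t ht.le x), Fin.sum_univ_add, Fin.sum_univ_add,
    ← add_assoc]
  have h1 : ∀ i : Fin t, (extendPath t u z : PathSp d (t + (1 + k))) (Fin.castAdd _ i) = u i := by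
    intro i; simp [extendPath]
  have h2 : (extendPath t u z : PathSp d (t + (1 + k))) (Fin.natAdd t (Fin.castAdd k 0)) = z := by
    simp [extendPath]
  have h3 : ∀ i : Fin k, (extendPath t u z : PathSp d (t + (1 + k))) (Fin.natAdd t (Fin.natAdd 1 i))
      = 0 := by
    intro i; simp [extendPath]
  simp only [h1, h3, Finset.univ_unique, Fin.default_eq_zero, Finset.sum_singleton, h2,
    inner_zero_right, Finset.sum_const_zero, add_zero]
  rfl

lemma norm_extendPath_sq (t : ℕ) (ht : t < T) (u : PathSp d t) (z : St d) :
    ‖(extendPath t u z : PathSp d T)‖ ^ 2 = ‖u‖ ^ 2 + ‖z‖ ^ 2 := by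
  rw [← real_inner_self_eq_norm_sq, inner_extendPath t ht, initSeg_extendPath,
    nextState_extendPath, real_inner_self_eq_norm_sq, real_inner_self_eq_norm_sq]

lemma norm_initSeg_sq_add_norm_nextState_sq_le (t : ℕ) (ht : t < T) (x : PathSp d T) :
    ‖initSeg t ht.le x‖ ^ 2 + ‖nextState t ht x‖ ^ 2 ≤ ‖x‖ ^ 2 := by
  have h := inner_extendPath t ht x (initSeg t ht.le x) (nextState t ht x)
  rw [real_inner_self_eq_norm_sq, real_inner_self_eq_norm_sq, ← norm_extendPath_sq t ht] at h
  have h2 := real_inner_le_norm x (extendPath t (initSeg t ht.le x) (nextState t ht x))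
  rw [← norm_extendPath_sq t ht]
  nlinarith [norm_nonneg x, norm_nonneg (extendPath t (initSeg t ht.le x) (nextState t ht x) :
    PathSp d T)]

lemma norm_initSeg_le (t : ℕ) (ht : t < T) (x : PathSp d T) : ‖initSeg t ht.le x‖ ≤ ‖x‖ :=
  (pow_le_pow_iff_left₀ (norm_nonneg _) (norm_nonneg _) two_ne_zero).1
    ((le_add_of_nonneg_right (by positivity)).trans
      (norm_initSeg_sq_add_norm_nextState_sq_le t ht x))

lemma norm_nextState_le (t : ℕ) (ht : t < T) (x : PathSp d T) : ‖nextState t ht x‖ ≤ ‖x‖ :=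
  (pow_le_pow_iff_left₀ (norm_nonneg _) (norm_nonneg _) two_ne_zero).1
    ((le_add_of_nonneg_left (by positivity)).trans
      (norm_initSeg_sq_add_norm_nextState_sq_le t ht x))

/-- By adjointness and |(u, z)|² = |u|² + |z|², the Gaussian characteristic function factorises over
the two blocks. -/
lemma map_gaussMeasure_initSeg_nextState {σ : ℝ} (hσ : 0 < σ) (t : ℕ) (ht : t < T) :
    (gaussMeasure (PathSp d T) σ).map (fun x => (initSeg t ht.le x, nextState t ht x)) =
      (gaussMeasure (PathSp d t) σ).prod (gaussMeasure (St d) σ) := by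
  have := isFiniteMeasure_gaussMeasure (E := PathSp d T) hσ
  have := isFiniteMeasure_gaussMeasure (E := PathSp d t) hσ
  have := isFiniteMeasure_gaussMeasure (E := St d) hσ
  have hm : Measurable fun x : PathSp d T => (initSeg t ht.le x, nextState t ht x) :=
    (measurable_initSeg t ht.le).prodMk (measurable_nextState t ht)
  rw [← charFun_eq_prod_iff]
  intro s
  have h : charFun (((gaussMeasure (PathSp d T) σ).map
      (fun x => (initSeg t ht.le x, nextState t ht x))).map (WithLp.toLp 2)) s =
      charFun (gaussMeasure (PathSp d T) σ) (extendPath t (WithLp.ofLp s).1 (WithLp.ofLp s).2) := by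
    rw [charFun_apply, charFun_apply, Measure.map_map (by fun_prop) hm,
      integral_map (by fun_prop) (by fun_prop)]
    congr 1
    ext x
    rw [inner_extendPath t ht]
    simp [WithLp.prod_inner_apply]
  rw [h, charFun_gaussMeasure hσ, charFun_gaussMeasure hσ, charFun_gaussMeasure hσ,
    ← Complex.exp_add, ← Complex.ofReal_pow ‖extendPath _ _ _‖, norm_extendPath_sq t ht]
  congr 1
  push_cast
  ring

end Paths

/-! ### The kernel as a Gaussian mixture and as a regular conditional law. -/

section SmoothedKernel

variable {d T : ℕ} {σ : ℝ} {μ : Measure (PathSp d T)} {t : ℕ} {ht : t < T}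

lemma measurable_jointDensity [SFinite μ] :
    Measurable (Function.uncurry (jointDensity σ μ t ht)) := by
  have h1 := (continuous_gaussDensity (E := PathSp d t) σ).measurable
  have h2 := (continuous_gaussDensity (E := St d) σ).measurable
  have h3 := measurable_initSeg (d := d) t ht.le
  have h4 := measurable_nextState (d := d) t ht
  unfold Function.uncurry jointDensity
  apply Measurable.lintegral_prod_right'
    (f := fun q : (PathSp d t × St d) × PathSp d T => ENNReal.ofReal
      (gaussDensity σ (q.1.1 - initSeg t ht.le q.2) * gaussDensity σ (q.1.2 - nextState t ht q.2)))
  fun_prop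

lemma measurable_initialDensity [SFinite μ] : Measurable (initialDensity σ μ t ht) := by
  have h1 := (continuous_gaussDensity (E := PathSp d t) σ).measurable
  have h3 := measurable_initSeg (d := d) t ht.le
  unfold initialDensity
  apply Measurable.lintegral_prod_right'
    (f := fun q : PathSp d t × PathSp d T => ENNReal.ofReal
      (gaussDensity σ (q.1 - initSeg t ht.le q.2)))
  fun_prop

lemma initialDensity_ne_zero (hσ : 0 < σ) [IsProbabilityMeasure μ] (u : PathSp d t) :
    initialDensity σ μ t ht u ≠ 0 := by
  have h1 := (continuous_gaussDensity (E := PathSp d t) σ).measurable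
  have h3 := measurable_initSeg (d := d) t ht.le
  unfold initialDensity
  rw [Ne, lintegral_eq_zero_iff (by fun_prop)]
  intro h
  obtain ⟨w, hw⟩ := h.exists
  exact (ENNReal.ofReal_pos.2 (gaussDensity_pos hσ _)).ne' hw

lemma initialDensity_ne_top [IsProbabilityMeasure μ] (u : PathSp d t) :
    initialDensity σ μ t ht u ≠ ∞ := by
  refine ne_top_of_le_ne_top (b := ENNReal.ofReal
    ((2 * Real.pi * σ ^ 2) ^ (-(Module.finrank ℝ (PathSp d t) : ℝ) / 2))) ENNReal.ofReal_ne_top ?_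
  refine (lintegral_mono (g := fun _ => ENNReal.ofReal
    ((2 * Real.pi * σ ^ 2) ^ (-(Module.finrank ℝ (PathSp d t) : ℝ) / 2))) fun w => ?_).trans_eq
    (by simp)
  refine ENNReal.ofReal_le_ofReal (mul_le_of_le_one_right (by positivity) ?_)
  rw [Real.exp_le_one_iff, neg_div]
  have := sq_nonneg ‖u - initSeg t ht.le w‖
  have : 0 ≤ ‖u - initSeg t ht.le w‖ ^ 2 / (2 * σ ^ 2) := by positivity
  linarith

lemma lintegral_jointDensity_mul (hσ : 0 < σ) [SFinite μ] (u : PathSp d t) {h : St d → ℝ≥0∞}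
    (hh : Measurable h) :
    ∫⁻ z, jointDensity σ μ t ht u z * h z =
      ∫⁻ w, ENNReal.ofReal (gaussDensity σ (u - initSeg t ht.le w)) *
        ∫⁻ n, h (nextState t ht w + n) ∂gaussMeasure (St d) σ ∂μ := by
  have h1 := (continuous_gaussDensity (E := PathSp d t) σ).measurable
  have h2 := (continuous_gaussDensity (E := St d) σ).measurable
  have h3 := measurable_initSeg (d := d) t ht.le
  have h4 := measurable_nextState (d := d) t ht
  unfold jointDensity
  calc _ = ∫⁻ z, ∫⁻ w, ENNReal.ofReal (gaussDensity σ (u - initSeg t ht.le w) *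
              gaussDensity σ (z - nextState t ht w)) * h z ∂μ := by
        refine lintegral_congr fun z => ?_
        rw [lintegral_mul_const _ (by fun_prop)]
    _ = ∫⁻ w, ∫⁻ z, ENNReal.ofReal (gaussDensity σ (u - initSeg t ht.le w) *
              gaussDensity σ (z - nextState t ht w)) * h z ∂volume ∂μ :=
        lintegral_lintegral_swap (by unfold Function.uncurry; fun_prop)
    _ = _ := by
        refine lintegral_congr fun w => ?_
        rw [lintegral_gaussMeasure_add σ hh, ← lintegral_const_mul _ (by fun_prop)]
        refine lintegral_congr fun z => ?_
        rw [ENNReal.ofReal_mul (gaussDensity_pos hσ _).le, mul_assoc]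

lemma lintegral_smoothedKernel_eq_lintegral_density [SFinite μ] (u : PathSp d t)
    {h : St d → ℝ≥0∞} (hh : Measurable h) :
    ∫⁻ z, h z ∂smoothedKernel σ μ t ht u =
      ∫⁻ z, jointDensity σ μ t ht u z / initialDensity σ μ t ht u * h z := by
  have hj : Measurable fun z => jointDensity σ μ t ht u z :=
    Measurable.of_uncurry_left (f := jointDensity σ μ t ht) measurable_jointDensity
  have hf : Measurable fun z => jointDensity σ μ t ht u z / initialDensity σ μ t ht u :=
    hj.div measurable_const
  exact lintegral_withDensity_eq_lintegral_mul _ hf hh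

/-- Tonelli turns the quotient of densities into a mixture of Gaussians centred at the next states,
the form needed for transport. -/
lemma lintegral_smoothedKernel (hσ : 0 < σ) [IsProbabilityMeasure μ] (u : PathSp d t)
    {h : St d → ℝ≥0∞} (hh : Measurable h) :
    ∫⁻ z, h z ∂smoothedKernel σ μ t ht u =
      ∫⁻ w, ENNReal.ofReal (gaussDensity σ (u - initSeg t ht.le w)) / initialDensity σ μ t ht u *
        ∫⁻ n, h (nextState t ht w + n) ∂gaussMeasure (St d) σ ∂μ := by
  have hi : (initialDensity σ μ t ht u)⁻¹ ≠ ∞ := by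
    simpa using initialDensity_ne_zero hσ u
  rw [lintegral_smoothedKernel_eq_lintegral_density u hh]
  simp only [div_eq_mul_inv, mul_right_comm _ (initialDensity σ μ t ht u)⁻¹]
  rw [lintegral_mul_const' _ _ hi, lintegral_mul_const' _ _ hi, lintegral_jointDensity_mul hσ u hh]

lemma isProbabilityMeasure_smoothedKernel (hσ : 0 < σ) [IsProbabilityMeasure μ] (u : PathSp d t) :
    IsProbabilityMeasure (smoothedKernel σ μ t ht u) := by
  have := isProbabilityMeasure_gaussMeasure (E := St d) hσ
  constructor
  rw [← lintegral_one, lintegral_smoothedKernel hσ u measurable_const]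
  simp only [lintegral_one, measure_univ, mul_one, div_eq_mul_inv]
  rw [lintegral_mul_const' _ _ (by simpa using initialDensity_ne_zero hσ u)]
  exact ENNReal.mul_inv_cancel (initialDensity_ne_zero (ht := ht) hσ u)
    (initialDensity_ne_top (ht := ht) u)

lemma lintegral_map_smoothed (hσ : 0 < σ) [SFinite μ] {h : PathSp d t × St d → ℝ≥0∞}
    (hh : Measurable h) :
    ∫⁻ q, h q ∂(smoothed σ μ).map (fun x => (initSeg t ht.le x, nextState t ht x)) =
      ∫⁻ u, ∫⁻ z, jointDensity σ μ t ht u z * h (u, z) := by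
  have := isFiniteMeasure_gaussMeasure (E := PathSp d T) hσ
  have := isFiniteMeasure_gaussMeasure (E := PathSp d t) hσ
  have := isFiniteMeasure_gaussMeasure (E := St d) hσ
  have h1 := (continuous_gaussDensity (E := PathSp d t) σ).measurable
  have h3 := measurable_initSeg (d := d) t ht.le
  have h4 := measurable_nextState (d := d) t ht
  have hm : Measurable fun x : PathSp d T => (initSeg t ht.le x, nextState t ht x) := h3.prodMk h4
  have hN : gaussianNoise d T σ = gaussMeasure (PathSp d T) σ := (gaussMeasure_eq hσ).symm
  rw [smoothed, hN, lintegral_map hh hm,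
    Measure.lintegral_conv (f := fun x => h (initSeg t ht.le x, nextState t ht x)) (hh.comp hm)]
  have hin : ∀ u : PathSp d t, Measurable fun w : PathSp d T =>
      ∫⁻ n, h (u, nextState t ht w + n) ∂gaussMeasure (St d) σ := by
    intro u
    apply Measurable.lintegral_prod_right' (f := fun q : PathSp d T × St d =>
      h (u, nextState t ht q.1 + q.2))
    fun_prop
  have hin2 : Measurable fun q : PathSp d T × PathSp d t =>
      ∫⁻ n, h (q.2, nextState t ht q.1 + n) ∂gaussMeasure (St d) σ := by
    apply Measurable.lintegral_prod_right' (f := fun q : (PathSp d T × PathSp d t) × St d =>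
      h (q.1.2, nextState t ht q.1.1 + q.2))
    fun_prop
  calc _ = ∫⁻ w, ∫⁻ u, ENNReal.ofReal (gaussDensity σ (u - initSeg t ht.le w)) *
          ∫⁻ n, h (u, nextState t ht w + n) ∂gaussMeasure (St d) σ ∂volume ∂μ := by
        refine lintegral_congr fun w => ?_
        rw [← lintegral_gaussMeasure_add σ (h := fun u => ∫⁻ n, h (u, nextState t ht w + n)
          ∂gaussMeasure (St d) σ) (hin2.comp measurable_prodMk_left)]
        rw [← lintegral_prod (μ := gaussMeasure (PathSp d t) σ) (ν := gaussMeasure (St d) σ)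
          (f := fun q => h (initSeg t ht.le w + q.1, nextState t ht w + q.2)) (by fun_prop),
          ← map_gaussMeasure_initSeg_nextState hσ t ht, lintegral_map (by fun_prop) hm]
        rfl
    _ = ∫⁻ u, ∫⁻ w, ENNReal.ofReal (gaussDensity σ (u - initSeg t ht.le w)) *
          ∫⁻ n, h (u, nextState t ht w + n) ∂gaussMeasure (St d) σ ∂μ := by
        refine lintegral_lintegral_swap (Measurable.aemeasurable ?_)
        exact Measurable.mul (by fun_prop) hin2
    _ = _ := by
        refine lintegral_congr fun u => ?_
        rw [← lintegral_jointDensity_mul hσ u (h := fun z => h (u, z)) (by fun_prop)]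

lemma lintegral_fst_map_smoothed (hσ : 0 < σ) [SFinite μ] {h : PathSp d t → ℝ≥0∞}
    (hh : Measurable h) :
    ∫⁻ u, h u ∂((smoothed σ μ).map (fun x => (initSeg t ht.le x, nextState t ht x))).fst =
      ∫⁻ u, initialDensity σ μ t ht u * h u := by
  have := isProbabilityMeasure_gaussMeasure (E := St d) hσ
  have h1 := (continuous_gaussDensity (E := PathSp d t) σ).measurable
  have h3 := measurable_initSeg (d := d) t ht.le
  rw [Measure.fst, lintegral_map hh measurable_fst, lintegral_map_smoothed hσ (by fun_prop)]
  refine lintegral_congr fun u => ?_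
  rw [lintegral_jointDensity_mul hσ u (h := fun _ => h u) measurable_const, initialDensity,
    ← lintegral_mul_const _ (by fun_prop)]
  simp

/-- The conditional kernel as a measurable family of measures. -/
noncomputable def condKernelSmoothed (σ : ℝ) (μ : Measure (PathSp d T)) (t : ℕ) (ht : t < T) :
    Kernel (PathSp d t) (St d) :=
  (Kernel.const (PathSp d t) (volume : Measure (St d))).withDensity
    fun u z => jointDensity σ μ t ht u z / initialDensity σ μ t ht u

lemma condKernelSmoothed_apply [SFinite μ] (u : PathSp d t) :
    condKernelSmoothed σ μ t ht u = smoothedKernel σ μ t ht u := by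
  rw [condKernelSmoothed, Kernel.withDensity_apply, Kernel.const_apply]
  · rfl
  · exact measurable_jointDensity.div (measurable_initialDensity.comp measurable_fst)

lemma isMarkovKernel_condKernelSmoothed (hσ : 0 < σ) [IsProbabilityMeasure μ] :
    IsMarkovKernel (condKernelSmoothed σ μ t ht) :=
  ⟨fun u => by
    rw [condKernelSmoothed_apply]; exact isProbabilityMeasure_smoothedKernel hσ u⟩

/-- The marginal density cancels against the denominator of the kernel, since it is positive and
finite at every point. -/
lemma isCondKernel_condKernelSmoothed (hσ : 0 < σ) [IsProbabilityMeasure μ] :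
    ((smoothed σ μ).map fun x => (initSeg t ht.le x, nextState t ht x)).IsCondKernel
      (condKernelSmoothed σ μ t ht) := by
  have := isMarkovKernel_condKernelSmoothed (ht := ht) (μ := μ) hσ
  have : IsProbabilityMeasure (gaussianNoise d T σ) :=
    Measure.isProbabilityMeasure_map (by fun_prop)
  have : IsProbabilityMeasure (smoothed σ μ) := by unfold smoothed; infer_instance
  refine ⟨Measure.ext_of_lintegral _ fun h hh => ?_⟩
  rw [Measure.lintegral_compProd hh, lintegral_map_smoothed hσ hh,
    lintegral_fst_map_smoothed hσ hh.lintegral_kernel_prod_right']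
  refine lintegral_congr fun u => ?_
  rw [condKernelSmoothed_apply, lintegral_smoothedKernel_eq_lintegral_density u
      (h := fun z => h (u, z)) (by fun_prop),
    ← lintegral_const_mul' _ _ (initialDensity_ne_top u)]
  refine lintegral_congr fun z => ?_
  rw [← mul_assoc, ENNReal.mul_div_cancel (initialDensity_ne_zero hσ u)
    (initialDensity_ne_top u)]

end SmoothedKernel

/-! ### Transport of a small mass through a background of Gaussians. -/

section Coupling

/-- The common part R stays in place on the diagonal and costs nothing; the rest is coupled through
(A, B). -/
lemma wasserstein_le_of_common_part {E α : Type*} [PseudoEMetricSpace E] [MeasurableSpace E]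
    [OpensMeasurableSpace (E × E)] [MeasurableSpace α] {p : ℝ} (hp : 0 < p)
    {R μ ν : Measure E} {Λ : Measure α} {A B : α → E} (hA : Measurable A) (hB : Measurable B)
    (hμ : μ = R + Λ.map A) (hν : ν = R + Λ.map B) :
    wasserstein p μ ν ≤ (∫⁻ a, edist (A a) (B a) ^ p ∂Λ) ^ (1 / p) := by
  have hdiag : Measurable fun z : E => (z, z) := measurable_id.prodMk measurable_id
  have hAB : Measurable fun a => (A a, B a) := hA.prodMk hB
  have hd : Measurable fun z : E × E => edist z.1 z.2 ^ p :=
    (continuous_edist.measurable).pow_const p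
  refine ENNReal.rpow_le_rpow ?_ (by positivity)
  have h1 : (R.map (fun z => (z, z)) + Λ.map (fun a => (A a, B a))).map Prod.fst = μ := by
    rw [Measure.map_add _ _ measurable_fst, Measure.map_map measurable_fst hdiag,
      Measure.map_map measurable_fst hAB, hμ]
    congr 1
    exact Measure.map_id
  have h2 : (R.map (fun z => (z, z)) + Λ.map (fun a => (A a, B a))).map Prod.snd = ν := by
    rw [Measure.map_add _ _ measurable_snd, Measure.map_map measurable_snd hdiag,
      Measure.map_map measurable_snd hAB, hν]
    congr 1
    exact Measure.map_id
  refine (iInf₂_le (R.map (fun z => (z, z)) + Λ.map (fun a => (A a, B a))) ⟨h1, h2⟩).trans ?_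
  rw [lintegral_add_measure, lintegral_map hd hdiag, lintegral_map hd hAB]
  simp [hp]

/-- Lebesgue measure on (0, c + D] parametrises a uniform chain of mass c on [0, 1] followed by an
atom of mass D at 1. -/
lemma setLIntegral_Ioc_min {c D : ℝ} (hc : 0 < c) (hD : 0 ≤ D) (H : ℝ → ℝ≥0∞) :
    ∫⁻ v in Set.Ioc 0 (c + D), H (min (v / c) 1) =
      (∫⁻ v in Set.Ioc 0 c, H (v / c)) + ENNReal.ofReal D * H 1 := by
  rw [← Set.Ioc_union_Ioc_eq_Ioc hc.le (le_add_of_nonneg_right hD),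
    lintegral_union measurableSet_Ioc (Set.Ioc_disjoint_Ioc_of_le le_rfl)]
  congr 1
  · refine setLIntegral_congr_fun measurableSet_Ioc fun v hv => ?_
    rw [min_eq_left ((div_le_one hc).2 hv.2)]
  · rw [setLIntegral_congr_fun (g := fun _ => H 1) measurableSet_Ioc fun v hv => by
      beta_reduce
      rw [min_eq_right ((one_le_div hc).2 hv.1.le)]]
    simp [mul_comm]

/-- Companion parametrisation by the same interval: the atom of mass D now sits at 0 and comes
first. Matching equal v in the two is the shift by D. -/
lemma setLIntegral_Ioc_max {c D : ℝ} (hc : 0 < c) (hD : 0 ≤ D) (H : ℝ → ℝ≥0∞) :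
    ∫⁻ v in Set.Ioc 0 (c + D), H (max ((v - D) / c) 0) =
      (∫⁻ v in Set.Ioc 0 c, H (v / c)) + ENNReal.ofReal D * H 0 := by
  rw [add_comm c D, ← Set.Ioc_union_Ioc_eq_Ioc hD (le_add_of_nonneg_right hc.le),
    lintegral_union measurableSet_Ioc (Set.Ioc_disjoint_Ioc_of_le le_rfl), add_comm]
  congr 1
  · rw [← lintegral_indicator measurableSet_Ioc, ← lintegral_indicator measurableSet_Ioc,
      ← lintegral_sub_right_eq_self ((Set.Ioc 0 c).indicator _) D]
    refine lintegral_congr fun v => ?_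
    by_cases hv : v ∈ Set.Ioc D (D + c)
    · have hv' : v - D ∈ Set.Ioc 0 c := ⟨by linarith [hv.1], by linarith [hv.2]⟩
      rw [Set.indicator_of_mem hv, Set.indicator_of_mem hv',
        max_eq_left (div_nonneg hv'.1.le hc.le)]
    · have hv' : v - D ∉ Set.Ioc 0 c := fun h => hv ⟨by linarith [h.1], by linarith [h.2]⟩
      rw [Set.indicator_of_notMem hv, Set.indicator_of_notMem hv']
  · rw [setLIntegral_congr_fun (g := fun _ => H 0) measurableSet_Ioc fun v hv => by
      beta_reduce
      rw [max_eq_right (div_nonpos_of_nonpos_of_nonneg (by linarith [hv.2]) hc.le)]]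
    simp [mul_comm]

lemma setLIntegral_prod_Ioc {Ω : Type*} [MeasurableSpace Ω] (Q : Measure Ω) {ℓ : Ω → ℝ}
    (hℓ : Measurable ℓ) {H : Ω × ℝ → ℝ≥0∞} (hH : Measurable H) :
    ∫⁻ q in {q : Ω × ℝ | 0 < q.2 ∧ q.2 ≤ ℓ q.1}, H q ∂Q.prod volume =
      ∫⁻ ω, ∫⁻ v in Set.Ioc 0 (ℓ ω), H (ω, v) ∂volume ∂Q := by
  have hs : MeasurableSet {q : Ω × ℝ | 0 < q.2 ∧ q.2 ≤ ℓ q.1} :=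
    (measurableSet_lt measurable_const measurable_snd).inter
      (measurableSet_le measurable_snd (hℓ.comp measurable_fst))
  rw [← lintegral_indicator hs, lintegral_prod _ (hH.indicator hs).aemeasurable]
  refine lintegral_congr fun ω => ?_
  rw [← lintegral_indicator measurableSet_Ioc]
  rfl

lemma measurable_setLIntegral_Ioc {Ω : Type*} [MeasurableSpace Ω] {ℓ : Ω → ℝ}
    (hℓ : Measurable ℓ) {H : Ω × ℝ → ℝ≥0∞} (hH : Measurable H) :
    Measurable fun ω => ∫⁻ v in Set.Ioc 0 (ℓ ω), H (ω, v) := by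
  have hs : MeasurableSet {q : Ω × ℝ | 0 < q.2 ∧ q.2 ≤ ℓ q.1} :=
    (measurableSet_lt measurable_const measurable_snd).inter
      (measurableSet_le measurable_snd (hℓ.comp measurable_fst))
  have := (hH.indicator hs).lintegral_prod_right' (ν := volume)
  simp_rw [← lintegral_indicator (measurableSet_Ioc (a := (0 : ℝ)))]
  exact this

variable {E : Type*} [NormedAddCommGroup E] [InnerProductSpace ℝ E]

/-- The squared distance from z to a point of the segment is the convex combination of those to the
ends minus s(1-s)|b - b'|². As s(1-s) ≤ 1/4, the stated factor absorbs this loss, and the nearer end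
alone dominates. -/
lemma gaussDensity_segment_le {σ : ℝ} (hσ : 0 < σ) (z b b' : E) {s : ℝ} (h0 : 0 ≤ s) (h1 : s ≤ 1) :
    Real.exp (-‖b - b'‖ ^ 2 / (8 * σ ^ 2)) * gaussDensity σ (z - (b' + s • (b - b'))) ≤
      gaussDensity σ (z - b) + gaussDensity σ (z - b') := by
  have hid : ‖z - (b' + s • (b - b'))‖ ^ 2 =
      s * ‖z - b‖ ^ 2 + (1 - s) * ‖z - b'‖ ^ 2 - s * (1 - s) * ‖b - b'‖ ^ 2 := by
    have e1 : z - (b' + s • (b - b')) = (z - b') - s • (b - b') := by abel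
    have e2 : z - b = (z - b') - (b - b') := by abel
    rw [e1, e2, norm_sub_sq_real (z - b') (s • _), norm_sub_sq_real (z - b') (b - b'), inner_smul_right, norm_smul,
      Real.norm_of_nonneg h0]
    ring
  have hq : s * (1 - s) * ‖b - b'‖ ^ 2 ≤ ‖b - b'‖ ^ 2 / 4 := by
    nlinarith [mul_nonneg (sq_nonneg (s - 1 / 2)) (sq_nonneg ‖b - b'‖)]
  have key : ∀ y : E, ‖z - y‖ ^ 2 ≤ s * ‖z - b‖ ^ 2 + (1 - s) * ‖z - b'‖ ^ 2 →
      Real.exp (-‖b - b'‖ ^ 2 / (8 * σ ^ 2)) * gaussDensity σ (z - (b' + s • (b - b'))) ≤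
        gaussDensity σ (z - y) := by
    intro y hy
    unfold gaussDensity
    rw [mul_left_comm, ← Real.exp_add]
    refine mul_le_mul_of_nonneg_left (Real.exp_le_exp.2 ?_) (by positivity)
    have e : -‖b - b'‖ ^ 2 / (8 * σ ^ 2) + -‖z - (b' + s • (b - b'))‖ ^ 2 / (2 * σ ^ 2) =
        (-(‖b - b'‖ ^ 2 / 4) - ‖z - (b' + s • (b - b'))‖ ^ 2) / (2 * σ ^ 2) := by
      field_simp; ring
    rw [e]
    gcongr
    rw [hid]
    linarith
  rcases le_total (‖z - b‖ ^ 2) (‖z - b'‖ ^ 2) with h | h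
  · exact (key b (by nlinarith)).trans (le_add_of_nonneg_right (gaussDensity_pos hσ _).le)
  · exact (key b' (by nlinarith)).trans (le_add_of_nonneg_left (gaussDensity_pos hσ _).le)

variable [FiniteDimensional ℝ E] [MeasurableSpace E] [BorelSpace E]

lemma lintegral_setLIntegral_gaussMeasure_add (σ : ℝ) {h : E → ℝ≥0∞} (hh : Measurable h)
    {f : ℝ → E} (hf : Measurable f) (s : Set ℝ) :
    ∫⁻ v in s, ∫⁻ n, h (f v + n) ∂gaussMeasure E σ =
      ∫⁻ z, (∫⁻ v in s, ENNReal.ofReal (gaussDensity σ (z - f v))) * h z := by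
  have hg := (continuous_gaussDensity (E := E) σ).measurable
  simp_rw [lintegral_gaussMeasure_add σ hh]
  rw [lintegral_lintegral_swap (by unfold Function.uncurry; fun_prop)]
  refine lintegral_congr fun z => ?_
  rw [lintegral_mul_const _ (by fun_prop)]

/-- Mass `D` is moved from `b` to `b'` in the presence of a background mixture
`m / 2 * (N(b) + N(b'))`: the background contains Gaussians along the whole segment,
so that every point has to move only by a multiple of `D`. -/
lemma wasserstein_le_of_background {Ω : Type*} [MeasurableSpace Ω] {Q : Measure Ω} [SFinite Q]
    {σ p : ℝ} (hσ : 0 < σ) (hp : 0 < p) {b b' : Ω → E} (hb : Measurable b) (hb' : Measurable b')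
    {m D : Ω → ℝ} (hm : Measurable m) (hD : Measurable D) (hm0 : ∀ ω, 0 < m ω)
    (hD0 : ∀ ω, 0 ≤ D ω) {K K' : Measure E}
    (hK : ∀ h : E → ℝ≥0∞, Measurable h → ∫⁻ z, h z ∂K =
      ∫⁻ ω, ENNReal.ofReal (m ω / 2) * ((∫⁻ n, h (b ω + n) ∂gaussMeasure E σ) +
          ∫⁻ n, h (b' ω + n) ∂gaussMeasure E σ) +
        ENNReal.ofReal (D ω) * ∫⁻ n, h (b ω + n) ∂gaussMeasure E σ ∂Q)
    (hK' : ∀ h : E → ℝ≥0∞, Measurable h → ∫⁻ z, h z ∂K' =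
      ∫⁻ ω, ENNReal.ofReal (m ω / 2) * ((∫⁻ n, h (b ω + n) ∂gaussMeasure E σ) +
          ∫⁻ n, h (b' ω + n) ∂gaussMeasure E σ) +
        ENNReal.ofReal (D ω) * ∫⁻ n, h (b' ω + n) ∂gaussMeasure E σ ∂Q)
    {c : Ω → ℝ} (hc : ∀ ω, c ω = m ω / 2 * Real.exp (-‖b ω - b' ω‖ ^ 2 / (8 * σ ^ 2))) :
    wasserstein p K K' ≤ (∫⁻ ω, ENNReal.ofReal
      ((c ω + D ω) * (min 1 (D ω / c ω) * ‖b ω - b' ω‖) ^ p) ∂Q) ^ (1 / p) := by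
  have := isProbabilityMeasure_gaussMeasure (E := E) hσ
  have hg := (continuous_gaussDensity (E := E) σ).measurable
  have hcm : Measurable c := by
    rw [show c = _ from funext hc]; fun_prop
  have hc0 : ∀ ω, 0 < c ω := fun ω => by
    rw [hc]; exact mul_pos (half_pos (hm0 ω)) (Real.exp_pos _)
  -- For fixed ω, P₁ is the density of the background and P₂ that of the chain carved out of it; c
  -- is chosen so that P₂ ≤ P₁.
  set P₁ : Ω → E → ℝ≥0∞ := fun ω z => ENNReal.ofReal (m ω / 2) *
    (ENNReal.ofReal (gaussDensity σ (z - b ω)) + ENNReal.ofReal (gaussDensity σ (z - b' ω))) with hP₁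
  set P₂ : Ω → E → ℝ≥0∞ := fun ω z => ∫⁻ v in Set.Ioc 0 (c ω),
    ENNReal.ofReal (gaussDensity σ (z - (b' ω + (v / c ω) • (b ω - b' ω)))) with hP₂
  have hP₁m : Measurable fun q : Ω × E => P₁ q.1 q.2 := by fun_prop
  have hP₂m : Measurable fun q : Ω × E => P₂ q.1 q.2 :=
    measurable_setLIntegral_Ioc (ℓ := fun q : Ω × E => c q.1) (by fun_prop)
      (H := fun r : (Ω × E) × ℝ => ENNReal.ofReal (gaussDensity σ
        (r.1.2 - (b' r.1.1 + (r.2 / c r.1.1) • (b r.1.1 - b' r.1.1))))) (by fun_prop)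
  have hP : ∀ ω z, P₂ ω z ≤ P₁ ω z := by
    intro ω z
    have hle : ∀ v ∈ Set.Ioc 0 (c ω),
        ENNReal.ofReal (gaussDensity σ (z - (b' ω + (v / c ω) • (b ω - b' ω)))) ≤
        ENNReal.ofReal ((gaussDensity σ (z - b ω) + gaussDensity σ (z - b' ω)) /
          Real.exp (-‖b ω - b' ω‖ ^ 2 / (8 * σ ^ 2))) := by
      intro v hv
      refine ENNReal.ofReal_le_ofReal ?_
      rw [le_div_iff₀' (Real.exp_pos _)]
      exact gaussDensity_segment_le hσ _ _ _ (div_nonneg hv.1.le (hc0 ω).le)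
        ((div_le_one (hc0 ω)).2 hv.2)
    refine (setLIntegral_mono measurable_const hle).trans_eq ?_
    rw [setLIntegral_const, Real.volume_Ioc, sub_zero,
      ← ENNReal.ofReal_mul (div_nonneg (add_nonneg (gaussDensity_pos hσ _).le
        (gaussDensity_pos hσ _).le) (Real.exp_pos _).le),
      hc]
    simp only [hP₁]
    rw [← ENNReal.ofReal_add (gaussDensity_pos hσ _).le (gaussDensity_pos hσ _).le,
      ← ENNReal.ofReal_mul (half_pos (hm0 ω)).le]
    congr 1
    field_simp
  -- What remains of the background once the chain is removed: the part that does not move.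
  set ρ : Measure E := (((Q.prod volume).withDensity fun q => P₁ q.1 q.2 - P₂ q.1 q.2).map Prod.snd)
    with hρ
  set Λ : Measure ((Ω × ℝ) × E) :=
    ((Q.prod volume).restrict {q : Ω × ℝ | 0 < q.2 ∧ q.2 ≤ c q.1 + D q.1}).prod (gaussMeasure E σ)
    with hΛ
  -- A lists the chain and then the atom at b; B lists the atom at b' and then the chain. The same
  -- noise is added to both.
  set A : (Ω × ℝ) × E → E := fun q =>
    b' q.1.1 + min (q.1.2 / c q.1.1) 1 • (b q.1.1 - b' q.1.1) + q.2 with hA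
  set B : (Ω × ℝ) × E → E := fun q =>
    b' q.1.1 + max ((q.1.2 - D q.1.1) / c q.1.1) 0 • (b q.1.1 - b' q.1.1) + q.2 with hB
  have hAm : Measurable A := by fun_prop
  have hBm : Measurable B := by fun_prop
  have hΛint : ∀ G : (Ω × ℝ) × E → ℝ≥0∞, Measurable G → ∫⁻ q, G q ∂Λ =
      ∫⁻ ω, ∫⁻ v in Set.Ioc 0 (c ω + D ω), ∫⁻ n, G ((ω, v), n) ∂gaussMeasure E σ ∂volume ∂Q := by
    intro G hG
    rw [hΛ, lintegral_prod _ hG.aemeasurable]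
    exact setLIntegral_prod_Ioc Q (hcm.add hD) hG.lintegral_prod_right'
  have hTm : ∀ h : E → ℝ≥0∞, Measurable h →
      Measurable fun x : E => ∫⁻ n, h (x + n) ∂gaussMeasure E σ := by
    intro h hh
    exact Measurable.lintegral_prod_right' (f := fun q : E × E => h (q.1 + q.2)) (by fun_prop)
  have hSm : ∀ h : E → ℝ≥0∞, Measurable h → Measurable fun ω => ∫⁻ v in Set.Ioc 0 (c ω),
      ∫⁻ n, h (b' ω + (v / c ω) • (b ω - b' ω) + n) ∂gaussMeasure E σ := by
    intro h hh
    exact measurable_setLIntegral_Ioc hcm (H := fun r : Ω × ℝ =>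
      ∫⁻ n, h (b' r.1 + (r.2 / c r.1) • (b r.1 - b' r.1) + n) ∂gaussMeasure E σ)
      ((hTm h hh).comp (by fun_prop))
  have hρint : ∀ h : E → ℝ≥0∞, Measurable h → ∫⁻ z, h z ∂ρ +
      ∫⁻ ω, ∫⁻ v in Set.Ioc 0 (c ω),
        ∫⁻ n, h (b' ω + (v / c ω) • (b ω - b' ω) + n) ∂gaussMeasure E σ ∂volume ∂Q =
      ∫⁻ ω, ENNReal.ofReal (m ω / 2) * ((∫⁻ n, h (b ω + n) ∂gaussMeasure E σ) +
          ∫⁻ n, h (b' ω + n) ∂gaussMeasure E σ) ∂Q := by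
    intro h hh
    have hsub : Measurable fun q : Ω × E => P₁ q.1 q.2 - P₂ q.1 q.2 := hP₁m.sub hP₂m
    have hdens : ∫⁻ q : Ω × E, h q.2 ∂(Q.prod volume).withDensity
        (fun q => P₁ q.1 q.2 - P₂ q.1 q.2) =
        ∫⁻ q : Ω × E, (P₁ q.1 q.2 - P₂ q.1 q.2) * h q.2 ∂Q.prod volume :=
      lintegral_withDensity_eq_lintegral_mul _ hsub (hh.comp measurable_snd)
    rw [hρ, lintegral_map hh measurable_snd, hdens,
      lintegral_prod (fun q : Ω × E => (P₁ q.1 q.2 - P₂ q.1 q.2) * h q.2)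
        (hsub.mul (hh.comp measurable_snd)).aemeasurable,
      ← lintegral_add_right _ (hSm h hh)]
    refine lintegral_congr fun ω => ?_
    have hP₂ω : Measurable (P₂ ω) := hP₂m.comp measurable_prodMk_left
    rw [lintegral_setLIntegral_gaussMeasure_add σ hh (f := fun v =>
      b' ω + (v / c ω) • (b ω - b' ω)) (by fun_prop)]
    have hP₂h : Measurable fun z => P₂ ω z * h z := hP₂ω.mul hh
    change (∫⁻ z, (P₁ ω z - P₂ ω z) * h z) + ∫⁻ z, P₂ ω z * h z = _
    rw [← lintegral_add_right _ hP₂h,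
      lintegral_gaussMeasure_add σ hh, lintegral_gaussMeasure_add σ hh,
      ← lintegral_add_left (by fun_prop), ← lintegral_const_mul _ (by fun_prop)]
    refine lintegral_congr fun z => ?_
    rw [← add_mul, tsub_add_cancel_of_le (hP ω z), hP₁]
    ring
  refine (wasserstein_le_of_common_part hp (R := ρ) (Λ := Λ) hAm hBm ?_ ?_).trans ?_
  · refine Measure.ext_of_lintegral _ fun h hh => ?_
    rw [lintegral_add_measure, lintegral_map hh hAm, hΛint (fun q => h (A q)) (hh.comp hAm), hK h hh]
    have : ∀ ω, ∫⁻ v in Set.Ioc 0 (c ω + D ω), ∫⁻ n, h (A ((ω, v), n)) ∂gaussMeasure E σ =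
        (∫⁻ v in Set.Ioc 0 (c ω),
          ∫⁻ n, h (b' ω + (v / c ω) • (b ω - b' ω) + n) ∂gaussMeasure E σ) +
        ENNReal.ofReal (D ω) * ∫⁻ n, h (b ω + n) ∂gaussMeasure E σ := by
      intro ω
      have := setLIntegral_Ioc_min (hc0 ω) (hD0 ω)
        (fun s => ∫⁻ n, h (b' ω + s • (b ω - b' ω) + n) ∂gaussMeasure E σ)
      simpa using this
    simp_rw [this]
    rw [lintegral_add_left (hSm h hh), ← add_assoc, hρint h hh, ← lintegral_add_right]
    exact (by fun_prop : Measurable fun ω => ENNReal.ofReal (D ω)).mul ((hTm h hh).comp hb)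
  · refine Measure.ext_of_lintegral _ fun h hh => ?_
    rw [lintegral_add_measure, lintegral_map hh hBm, hΛint (fun q => h (B q)) (hh.comp hBm), hK' h hh]
    have : ∀ ω, ∫⁻ v in Set.Ioc 0 (c ω + D ω), ∫⁻ n, h (B ((ω, v), n)) ∂gaussMeasure E σ =
        (∫⁻ v in Set.Ioc 0 (c ω),
          ∫⁻ n, h (b' ω + (v / c ω) • (b ω - b' ω) + n) ∂gaussMeasure E σ) +
        ENNReal.ofReal (D ω) * ∫⁻ n, h (b' ω + n) ∂gaussMeasure E σ := by
      intro ω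
      have := setLIntegral_Ioc_max (hc0 ω) (hD0 ω)
        (fun s => ∫⁻ n, h (b' ω + s • (b ω - b' ω) + n) ∂gaussMeasure E σ)
      simpa using this
    simp_rw [this]
    rw [lintegral_add_left (hSm h hh), ← add_assoc, hρint h hh, ← lintegral_add_right]
    exact (by fun_prop : Measurable fun ω => ENNReal.ofReal (D ω)).mul ((hTm h hh).comp hb')
  · refine ENNReal.rpow_le_rpow ?_ (by positivity)
    rw [hΛint _ ((hAm.edist hBm).pow_const p)]
    refine lintegral_mono fun ω => ?_
    have hbound : ∀ v ∈ Set.Ioc 0 (c ω + D ω),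
        ∫⁻ n, edist (A ((ω, v), n)) (B ((ω, v), n)) ^ p ∂gaussMeasure E σ ≤
        ENNReal.ofReal ((min 1 (D ω / c ω) * ‖b ω - b' ω‖) ^ p) := by
      intro v hv
      have hn : ∀ n, edist (A ((ω, v), n)) (B ((ω, v), n)) ^ p ≤
          ENNReal.ofReal ((min 1 (D ω / c ω) * ‖b ω - b' ω‖) ^ p) := by
        intro n
        have hmin0 : 0 ≤ min 1 (D ω / c ω) :=
          le_min zero_le_one (div_nonneg (hD0 ω) (hc0 ω).le)
        rw [← ENNReal.ofReal_rpow_of_nonneg (by positivity) hp.le]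
        refine ENNReal.rpow_le_rpow ?_ hp.le
        rw [edist_dist, dist_eq_norm]
        refine ENNReal.ofReal_le_ofReal ?_
        -- The noise cancels, so the displacement is along b - b'; its coefficient is at most min(1,
        -- D/c) in absolute value for 0 < v ≤ c + D.
        have e : A ((ω, v), n) - B ((ω, v), n) =
            (min (v / c ω) 1 - max ((v - D ω) / c ω) 0) • (b ω - b' ω) := by
          simp only [hA, hB]
          rw [sub_smul]; abel
        rw [e, norm_smul]
        refine mul_le_mul_of_nonneg_right ?_ (norm_nonneg _)
        have h1 : 0 ≤ v / c ω := div_nonneg hv.1.le (hc0 ω).le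
        have h2 : 0 ≤ D ω / c ω := div_nonneg (hD0 ω) (hc0 ω).le
        have h3 : v / c ω ≤ 1 + D ω / c ω := by
          have := div_le_div_of_nonneg_right hv.2 (hc0 ω).le
          rwa [add_div, div_self (hc0 ω).ne'] at this
        rw [Real.norm_eq_abs, abs_le, sub_div]
        grind
      refine (lintegral_mono hn).trans_eq ?_
      simp
    refine (setLIntegral_mono measurable_const hbound).trans_eq ?_
    rw [setLIntegral_const, Real.volume_Ioc, sub_zero, mul_comm,
      ← ENNReal.ofReal_mul (add_nonneg (hc0 ω).le (hD0 ω))]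

end Coupling

/-! ### Cost for one pair, and the kernels as mixtures over pairs of paths. -/

section Tilt

/-- The excess satisfies D ≤ F l for l > 0 and vanishes for l ≤ 0. For l ≤ 1 the chain mass c is
comparable to F e, so the cost 2 D^p c^(1-p) has the right order. For l > 1 the trivial bound by F
suffices, as every other factor is at least 1. -/
lemma transport_cost_le {p F L e l : ℝ} (hp : 1 < p) (hF : 0 < F) (he : 0 < e) (he1 : e ≤ 1)
    (hL : 0 ≤ L) {F' m D c : ℝ} (hF' : F' = F * Real.exp (-l)) (hm : m = min F F')
    (hD : D = max (F - F') 0) (hc : c = m / 2 * e) :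
    (c + D) * (min 1 (D / c) * L) ^ p ≤
      2 * (2 * Real.exp 1) ^ (p - 1) * F * (|l| * L) ^ p * e ^ (1 - p) := by
  have hF'0 : 0 < F' := hF' ▸ mul_pos hF (Real.exp_pos _)
  have hm0 : 0 < m := hm ▸ lt_min hF hF'0
  have hc0 : 0 < c := hc ▸ mul_pos (half_pos hm0) he
  have hD0 : 0 ≤ D := hD ▸ le_max_right _ _
  have hmin0 : 0 ≤ min 1 (D / c) := le_min zero_le_one (div_nonneg hD0 hc0.le)
  rw [Real.mul_rpow hmin0 hL, Real.mul_rpow (abs_nonneg l) hL]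
  suffices h : (c + D) * min 1 (D / c) ^ p ≤
      2 * (2 * Real.exp 1) ^ (p - 1) * F * |l| ^ p * e ^ (1 - p) by
    calc _ = ((c + D) * min 1 (D / c) ^ p) * L ^ p := by ring
      _ ≤ _ := mul_le_mul_of_nonneg_right h (by positivity)
      _ = _ := by ring
  rcases le_or_gt l 0 with hl | hl
  · have : F ≤ F' := by
      rw [hF']; exact le_mul_of_one_le_right hF.le (Real.one_le_exp (by linarith))
    have hDz : D = 0 := by rw [hD, max_eq_right (by linarith)]
    rw [hDz, zero_div, min_eq_right zero_le_one, Real.zero_rpow (by linarith), mul_zero]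
    positivity
  have hF'F : F' ≤ F := by
    rw [hF']; exact mul_le_of_le_one_right hF.le (Real.exp_le_one_iff.2 (by linarith))
  have hDe : D = F - F' := by rw [hD, max_eq_left (by linarith)]
  have hme : m = F' := by rw [hm, min_eq_right hF'F]
  have hDl : D ≤ F * l := by
    rw [hDe, hF']
    nlinarith [Real.add_one_le_exp (-l)]
  have hDpos : 0 < D := by
    rw [hDe, hF']
    nlinarith [Real.exp_lt_exp.2 (show -l < 0 by linarith), Real.exp_zero]
  rw [abs_of_pos hl]
  rcases le_or_gt l 1 with hl1 | hl1
  · have hc1 : F * e / (2 * Real.exp 1) ≤ c := by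
      rw [hc, hme, hF', div_le_iff₀ (by positivity)]
      have : 1 ≤ Real.exp (-l) * Real.exp 1 := by
        rw [← Real.exp_add]; exact Real.one_le_exp (by linarith)
      nlinarith [mul_pos hF he]
    -- If D ≤ c, then c + D ≤ 2c; if D ≥ c, then c + D ≤ 2D and (D/c)^(p-1) ≥ 1.
    have hstep : (c + D) * min 1 (D / c) ^ p ≤ 2 * (D ^ p * c ^ (1 - p)) := by
      have hid : D ^ p * c ^ (1 - p) = D * (D / c) ^ (p - 1) := by
        rw [Real.div_rpow hD0 hc0.le, Real.rpow_sub_one hDpos.ne',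
          show 1 - p = -(p - 1) by ring, Real.rpow_neg hc0.le]
        field_simp
      rcases le_total D c with h | h
      · rw [min_eq_right ((div_le_one hc0).2 h)]
        have : D ^ p * c ^ (1 - p) = c * (D / c) ^ p := by
          rw [Real.div_rpow hD0 hc0.le, Real.rpow_sub hc0, Real.rpow_one]
          field_simp
        rw [this, ← mul_assoc]
        exact mul_le_mul_of_nonneg_right (by linarith) (by positivity)
      · rw [min_eq_left ((one_le_div hc0).2 h), Real.one_rpow, mul_one, hid]
        have : 1 ≤ (D / c) ^ (p - 1) :=
          Real.one_le_rpow ((one_le_div hc0).2 h) (by linarith)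
        nlinarith
    refine hstep.trans ?_
    have h1 : D ^ p ≤ (F * l) ^ p := Real.rpow_le_rpow hD0 hDl (by linarith)
    have h2 : c ^ (1 - p) ≤ (F * e / (2 * Real.exp 1)) ^ (1 - p) :=
      Real.rpow_le_rpow_of_nonpos (by positivity) hc1 (by linarith)
    calc 2 * (D ^ p * c ^ (1 - p))
        ≤ 2 * ((F * l) ^ p * (F * e / (2 * Real.exp 1)) ^ (1 - p)) := by gcongr
      _ = _ := by
        rw [Real.mul_rpow hF.le hl.le, Real.div_rpow (by positivity) (by positivity),
          Real.mul_rpow hF.le he.le, show (1 : ℝ) - p = -(p - 1) by ring,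
          Real.rpow_neg (by positivity : 0 ≤ 2 * Real.exp 1), Real.rpow_neg hF.le,
          Real.rpow_sub_one hF.ne']
        field_simp
  · have hm1 : min 1 (D / c) ^ p ≤ 1 :=
      Real.rpow_le_one hmin0 (min_le_left _ _) (by linarith)
    have hcF : c + D ≤ F := by
      rw [hc, hDe, hme]
      nlinarith
    have h1 : 1 ≤ (2 * Real.exp 1) ^ (p - 1) :=
      Real.one_le_rpow (by linarith [Real.add_one_le_exp 1]) (by linarith)
    have h2 : 1 ≤ l ^ p := Real.one_le_rpow hl1.le (by linarith)
    have h3 : 1 ≤ e ^ (1 - p) := Real.one_le_rpow_of_pos_of_le_one_of_nonpos he he1 (by linarith)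
    calc (c + D) * min 1 (D / c) ^ p ≤ F * 1 :=
          mul_le_mul hcF hm1 (by positivity) hF.le
      _ ≤ F * (2 * (2 * Real.exp 1) ^ (p - 1) * l ^ p * e ^ (1 - p)) := by
          refine mul_le_mul_of_nonneg_left ?_ hF.le
          have h4 : 1 ≤ 2 * (2 * Real.exp 1) ^ (p - 1) := by linarith
          exact one_le_mul_of_one_le_of_one_le (one_le_mul_of_one_le_of_one_le h4 h2) h3
      _ = _ := by ring

variable {d T : ℕ} {σ : ℝ} {μ : Measure (PathSp d T)} {t : ℕ} {ht : t < T}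

/-- The density with respect to `μ` of the conditional law of the unperturbed path given that the
perturbed initial segment is `u`. -/
noncomputable def tiltWeight (σ : ℝ) (μ : Measure (PathSp d T)) (t : ℕ) (ht : t < T)
    (u : PathSp d t) (w : PathSp d T) : ℝ :=
  Real.exp (-‖u - initSeg t ht.le w‖ ^ 2 / (2 * σ ^ 2)) /
    ∫ w', Real.exp (-‖u - initSeg t ht.le w'‖ ^ 2 / (2 * σ ^ 2)) ∂μ

lemma integrable_exp_neg_norm_sub_initSeg [IsFiniteMeasure μ] (u : PathSp d t) :
    Integrable (fun w => Real.exp (-‖u - initSeg t ht.le w‖ ^ 2 / (2 * σ ^ 2))) μ := by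
  have h3 := measurable_initSeg (d := d) t ht.le
  refine Integrable.of_bound (C := 1) (by fun_prop) (ae_of_all _ fun w => ?_)
  rw [Real.norm_of_nonneg (Real.exp_pos _).le, Real.exp_le_one_iff, neg_div, neg_nonpos]
  positivity

lemma integral_exp_neg_norm_sub_initSeg_pos [IsProbabilityMeasure μ] (u : PathSp d t) :
    0 < ∫ w, Real.exp (-‖u - initSeg t ht.le w‖ ^ 2 / (2 * σ ^ 2)) ∂μ :=
  integral_exp_pos (integrable_exp_neg_norm_sub_initSeg (ht := ht) u)

lemma tiltWeight_pos [IsProbabilityMeasure μ] (u : PathSp d t) (w : PathSp d T) :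
    0 < tiltWeight σ μ t ht u w :=
  div_pos (Real.exp_pos _) (integral_exp_neg_norm_sub_initSeg_pos (ht := ht) u)

lemma measurable_tiltWeight (u : PathSp d t) : Measurable (tiltWeight σ μ t ht u) := by
  have h3 := measurable_initSeg (d := d) t ht.le
  unfold tiltWeight
  fun_prop

lemma lintegral_tiltWeight [IsProbabilityMeasure μ] (u : PathSp d t) :
    ∫⁻ w, ENNReal.ofReal (tiltWeight σ μ t ht u w) ∂μ = 1 := by
  have hI := integral_exp_neg_norm_sub_initSeg_pos (σ := σ) (μ := μ) (ht := ht) u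
  have hint : Integrable (tiltWeight σ μ t ht u) μ :=
    (integrable_exp_neg_norm_sub_initSeg (ht := ht) u).div_const _
  rw [← ofReal_integral_eq_lintegral_ofReal hint (ae_of_all _ fun w => (tiltWeight_pos u w).le)]
  unfold tiltWeight
  rw [integral_div, div_self hI.ne', ENNReal.ofReal_one]

lemma gaussDensity_div_initialDensity (hσ : 0 < σ) [IsProbabilityMeasure μ] (u : PathSp d t)
    (w : PathSp d T) :
    ENNReal.ofReal (gaussDensity σ (u - initSeg t ht.le w)) / initialDensity σ μ t ht u =
      ENNReal.ofReal (tiltWeight σ μ t ht u w) := by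
  have hk : 0 < (2 * Real.pi * σ ^ 2) ^ (-(Module.finrank ℝ (PathSp d t) : ℝ) / 2) := by positivity
  have hI := integral_exp_neg_norm_sub_initSeg_pos (σ := σ) (μ := μ) (ht := ht) u
  have : initialDensity σ μ t ht u = ENNReal.ofReal
      ((2 * Real.pi * σ ^ 2) ^ (-(Module.finrank ℝ (PathSp d t) : ℝ) / 2) *
        ∫ w', Real.exp (-‖u - initSeg t ht.le w'‖ ^ 2 / (2 * σ ^ 2)) ∂μ) := by
    rw [← integral_const_mul, ofReal_integral_eq_lintegral_ofReal
      ((integrable_exp_neg_norm_sub_initSeg (ht := ht) u).const_mul _) (ae_of_all _ fun w => by positivity)]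
    rfl
  rw [this, ← ENNReal.ofReal_div_of_pos (mul_pos hk hI), gaussDensity, tiltWeight,
    mul_div_mul_left _ _ hk.ne']

/-- Normalising constants and squared norms cancel on exchanging u and v; only the cross term
remains, and it is linear in u - v. -/
lemma tiltWeight_mul_swap (hσ : 0 < σ) [IsProbabilityMeasure μ] (u v : PathSp d t)
    (w w' : PathSp d T) :
    tiltWeight σ μ t ht u w' * tiltWeight σ μ t ht v w =
      tiltWeight σ μ t ht u w * tiltWeight σ μ t ht v w' *
        Real.exp (-(inner ℝ (u - v) (initSeg t ht.le w - initSeg t ht.le w') / σ ^ 2)) := by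
  unfold tiltWeight
  rw [div_mul_div_comm, div_mul_div_comm, div_mul_eq_mul_div, ← Real.exp_add, ← Real.exp_add,
    ← Real.exp_add]
  congr 2
  simp only [norm_sub_sq_real, inner_sub_left, inner_sub_right]
  field_simp
  ring

lemma lintegral_mul_symm_prod {α : Type*} [MeasurableSpace α] {μ : Measure α} [SFinite μ]
    {m : α × α → ℝ≥0∞} (hm : Measurable m) (hsymm : ∀ q, m q.swap = m q) {g : α → ℝ≥0∞}
    (hg : Measurable g) :
    ∫⁻ q, 2⁻¹ * m q * (g q.1 + g q.2) ∂μ.prod μ = ∫⁻ q, m q * g q.1 ∂μ.prod μ := by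
  have hsw : ∫⁻ q, m q * g q.2 ∂μ.prod μ = ∫⁻ q, m q * g q.1 ∂μ.prod μ := by
    rw [← lintegral_prod_swap]
    simp [hsymm]
  simp_rw [mul_assoc, mul_add]
  rw [lintegral_add_left (by fun_prop), lintegral_const_mul _ (by fun_prop),
    lintegral_const_mul _ (by fun_prop), hsw, ← add_mul, ENNReal.inv_two_add_inv_two, one_mul]

/-- The weight of a pair of paths drawn from the two tilted measures. -/
noncomputable def pairWeight (σ : ℝ) (μ : Measure (PathSp d T)) (t : ℕ) (ht : t < T)
    (u v : PathSp d t) (q : PathSp d T × PathSp d T) : ℝ :=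
  tiltWeight σ μ t ht u q.1 * tiltWeight σ μ t ht v q.2

lemma pairWeight_pos [IsProbabilityMeasure μ] (u v : PathSp d t) (q : PathSp d T × PathSp d T) :
    0 < pairWeight σ μ t ht u v q := mul_pos (tiltWeight_pos _ _) (tiltWeight_pos _ _)

lemma measurable_pairWeight (u v : PathSp d t) : Measurable (pairWeight σ μ t ht u v) :=
  ((measurable_tiltWeight u).comp measurable_fst).mul ((measurable_tiltWeight v).comp measurable_snd)

lemma lintegral_pairWeight [IsProbabilityMeasure μ] (u v : PathSp d t) :
    ∫⁻ q, ENNReal.ofReal (pairWeight σ μ t ht u v q) ∂μ.prod μ = 1 := by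
  simp_rw [pairWeight, ENNReal.ofReal_mul (tiltWeight_pos _ _).le]
  rw [lintegral_prod_mul (measurable_tiltWeight u).ennreal_ofReal.aemeasurable
    (measurable_tiltWeight v).ennreal_ofReal.aemeasurable, lintegral_tiltWeight,
    lintegral_tiltWeight, one_mul]

/-- Inserting the second weight, of total mass 1, puts both kernels over the same space of pairs. -/
lemma lintegral_smoothedKernel_eq_fst (hσ : 0 < σ) [IsProbabilityMeasure μ] (u v : PathSp d t)
    {h : St d → ℝ≥0∞} (hh : Measurable h) :
    ∫⁻ z, h z ∂smoothedKernel σ μ t ht u =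
      ∫⁻ q, ENNReal.ofReal (pairWeight σ μ t ht u v q) *
        ∫⁻ n, h (nextState t ht q.1 + n) ∂gaussMeasure (St d) σ ∂μ.prod μ := by
  have := isProbabilityMeasure_gaussMeasure (E := St d) hσ
  have h4 := measurable_nextState (d := d) t ht
  have hT : Measurable fun w => ∫⁻ n, h (nextState t ht w + n) ∂gaussMeasure (St d) σ :=
    Measurable.lintegral_prod_right' (f := fun q : PathSp d T × St d =>
      h (nextState t ht q.1 + q.2)) (by fun_prop)
  have hTu : Measurable fun w => ENNReal.ofReal (tiltWeight σ μ t ht u w) *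
      ∫⁻ n, h (nextState t ht w + n) ∂gaussMeasure (St d) σ :=
    (measurable_tiltWeight u).ennreal_ofReal.mul hT
  rw [lintegral_smoothedKernel hσ u hh]
  simp_rw [gaussDensity_div_initialDensity hσ]
  rw [← mul_one (lintegral _ _), ← lintegral_tiltWeight (σ := σ) (μ := μ) (ht := ht) v,
    ← lintegral_prod_mul hTu.aemeasurable
      (measurable_tiltWeight v).ennreal_ofReal.aemeasurable]
  refine lintegral_congr fun q => ?_
  rw [pairWeight, ENNReal.ofReal_mul (tiltWeight_pos _ _).le, mul_right_comm]

lemma pairWeight_swap (u v : PathSp d t) (q : PathSp d T × PathSp d T) :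
    pairWeight σ μ t ht u v q.swap = pairWeight σ μ t ht v u q := mul_comm _ _

/-- Write F = min(F, F') + (F - F')⁺. The minimum is invariant under exchanging the paths of a pair,
so its mass at b can be shared equally between b and b'. -/
lemma lintegral_smoothedKernel_eq_background (hσ : 0 < σ) [IsProbabilityMeasure μ]
    (u v : PathSp d t) {h : St d → ℝ≥0∞} (hh : Measurable h) :
    ∫⁻ z, h z ∂smoothedKernel σ μ t ht u =
      ∫⁻ q, ENNReal.ofReal (min (pairWeight σ μ t ht u v q) (pairWeight σ μ t ht v u q) / 2) *
          ((∫⁻ n, h (nextState t ht q.1 + n) ∂gaussMeasure (St d) σ) +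
            ∫⁻ n, h (nextState t ht q.2 + n) ∂gaussMeasure (St d) σ) +
        ENNReal.ofReal (max (pairWeight σ μ t ht u v q - pairWeight σ μ t ht v u q) 0) *
          ∫⁻ n, h (nextState t ht q.1 + n) ∂gaussMeasure (St d) σ ∂μ.prod μ := by
  have := isProbabilityMeasure_gaussMeasure (E := St d) hσ
  have h4 := measurable_nextState (d := d) t ht
  have hT : Measurable fun w => ∫⁻ n, h (nextState t ht w + n) ∂gaussMeasure (St d) σ :=
    Measurable.lintegral_prod_right' (f := fun q : PathSp d T × St d =>
      h (nextState t ht q.1 + q.2)) (by fun_prop)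
  have hu := measurable_pairWeight (σ := σ) (μ := μ) (ht := ht) u v
  have hv := measurable_pairWeight (σ := σ) (μ := μ) (ht := ht) v u
  have hmin := lintegral_mul_symm_prod (μ := μ) (m := fun q => ENNReal.ofReal
    (min (pairWeight σ μ t ht u v q) (pairWeight σ μ t ht v u q))) (by fun_prop)
    (fun q => by rw [pairWeight_swap, pairWeight_swap, min_comm]) hT
  have hhalf : ∀ r : ℝ, ENNReal.ofReal (r / 2) = 2⁻¹ * ENNReal.ofReal r := fun r => by
    rw [ENNReal.ofReal_div_of_pos two_pos, ENNReal.ofReal_ofNat, div_eq_mul_inv, mul_comm]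
  have hT1 : Measurable fun q : PathSp d T × PathSp d T =>
      ∫⁻ n, h (nextState t ht q.1 + n) ∂gaussMeasure (St d) σ := hT.comp measurable_fst
  rw [lintegral_smoothedKernel_eq_fst hσ u v hh, lintegral_add_right _ (by fun_prop)]
  simp_rw [hhalf]
  rw [hmin, ← lintegral_add_right _ (by fun_prop)]
  refine lintegral_congr fun q => ?_
  rw [← add_mul, ← ENNReal.ofReal_add (le_min (pairWeight_pos u v q).le (pairWeight_pos v u q).le)
    (le_max_right _ _)]
  congr 2
  rcases le_total (pairWeight σ μ t ht u v q) (pairWeight σ μ t ht v u q) with h | h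
  · rw [min_eq_left h, max_eq_right (by linarith), add_zero]
  · rw [min_eq_right h, max_eq_left (by linarith)]; ring

end Tilt

/-! ### The Lipschitz estimate, first for bounded support. -/

section Main

variable {d T : ℕ} {σ p : ℝ} {μ : Measure (PathSp d T)} {t : ℕ} {ht : t < T}

/-- The constant in the Lipschitz estimate. -/
noncomputable def transportConst (p σ : ℝ) : ℝ :=
  2 * (2 * Real.exp 1) ^ (p - 1) * (1 / σ ^ 2) ^ p

lemma transportConst_pos (hσ : 0 < σ) : 0 < transportConst p σ := by
  unfold transportConst; positivity

/-- The cost of transporting between two components, as a function of the squared distance of the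
corresponding paths. -/
noncomputable def pairCost (p σ r : ℝ) : ℝ := r ^ p * Real.exp ((p - 1) * r / (8 * σ ^ 2))

lemma pairCost_mono (hp : 1 < p) {r s : ℝ} (hr : 0 ≤ r) (hrs : r ≤ s) :
    pairCost p σ r ≤ pairCost p σ s := by
  have : 0 ≤ p - 1 := by linarith
  have : 0 ≤ s := hr.trans hrs
  unfold pairCost
  gcongr

lemma wasserstein_smoothedKernel_le (hp : 1 < p) (hσ : 0 < σ) [IsProbabilityMeasure μ]
    (u v : PathSp d t) :
    wasserstein p (smoothedKernel σ μ t ht u) (smoothedKernel σ μ t ht v) ≤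
      (∫⁻ q, ENNReal.ofReal (transportConst p σ * ‖u - v‖ ^ p *
        (pairWeight σ μ t ht u v q * pairCost p σ (‖q.1 - q.2‖ ^ 2))) ∂μ.prod μ) ^ (1 / p) := by
  have h4 := measurable_nextState (d := d) t ht
  have hu := measurable_pairWeight (σ := σ) (μ := μ) (ht := ht) u v
  have hv := measurable_pairWeight (σ := σ) (μ := μ) (ht := ht) v u
  refine (wasserstein_le_of_background (Q := μ.prod μ) hσ (by linarith : 0 < p)
    (b := fun q => nextState t ht q.1) (b' := fun q => nextState t ht q.2)
    (m := fun q => min (pairWeight σ μ t ht u v q) (pairWeight σ μ t ht v u q))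
    (D := fun q => max (pairWeight σ μ t ht u v q - pairWeight σ μ t ht v u q) 0)
    (by fun_prop) (by fun_prop) (by fun_prop) (by fun_prop)
    (fun q => lt_min (pairWeight_pos u v q) (pairWeight_pos v u q)) (fun q => le_max_right _ _)
    (fun h hh => lintegral_smoothedKernel_eq_background hσ u v hh) ?_ (fun q => rfl)).trans ?_
  -- The decomposition at v, read with the two paths of the pair exchanged, has the same background
  -- and places the same excess D at b'.
  · intro h hh
    rw [lintegral_smoothedKernel_eq_background hσ v u hh, ← lintegral_prod_swap]
    refine lintegral_congr fun q => ?_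
    rw [pairWeight_swap, pairWeight_swap, Prod.fst_swap, Prod.snd_swap,
      add_comm (∫⁻ n, h (nextState t ht q.2 + n) ∂gaussMeasure (St d) σ)]
  refine ENNReal.rpow_le_rpow (lintegral_mono fun q => ENNReal.ofReal_le_ofReal ?_)
    (by have : 0 < p := by linarith
        positivity)
  have hF := pairWeight_pos (σ := σ) (μ := μ) (ht := ht) u v q
  set a := initSeg t ht.le q.1
  set a' := initSeg t ht.le q.2
  set b := nextState t ht q.1
  set b' := nextState t ht q.2
  have he1 : Real.exp (-‖b - b'‖ ^ 2 / (8 * σ ^ 2)) ≤ 1 := by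
    rw [Real.exp_le_one_iff, neg_div, neg_nonpos]; positivity
  have hswap : pairWeight σ μ t ht v u q = pairWeight σ μ t ht u v q *
      Real.exp (-(inner ℝ (u - v) (a - a') / σ ^ 2)) := by
    rw [← pairWeight_swap u v q]
    exact tiltWeight_mul_swap hσ u v q.1 q.2
  refine (transport_cost_le hp hF (Real.exp_pos _) he1 (norm_nonneg (b - b')) hswap rfl rfl
    rfl).trans ?_
  have ha : ‖a - a'‖ ≤ ‖q.1 - q.2‖ := norm_initSeg_le t ht (q.1 - q.2)
  have hb : ‖b - b'‖ ≤ ‖q.1 - q.2‖ := norm_nextState_le t ht (q.1 - q.2)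
  -- One factor |w - w'| comes from the log-ratio of the weights, the other from the distance
  -- travelled.
  have hl : |inner ℝ (u - v) (a - a') / σ ^ 2| * ‖b - b'‖ ≤
      1 / σ ^ 2 * ‖u - v‖ * ‖q.1 - q.2‖ ^ 2 := by
    rw [abs_div, abs_of_pos (by positivity : 0 < σ ^ 2)]
    calc |inner ℝ (u - v) (a - a')| / σ ^ 2 * ‖b - b'‖
        ≤ ‖u - v‖ * ‖q.1 - q.2‖ / σ ^ 2 * ‖q.1 - q.2‖ := by
          gcongr
          exact (abs_real_inner_le_norm _ _).trans (by gcongr)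
      _ = _ := by ring
  have hexp : Real.exp (-‖b - b'‖ ^ 2 / (8 * σ ^ 2)) ^ (1 - p) ≤
      Real.exp ((p - 1) * ‖q.1 - q.2‖ ^ 2 / (8 * σ ^ 2)) := by
    rw [← Real.exp_mul]
    refine Real.exp_le_exp.2 ?_
    rw [div_mul_eq_mul_div]
    have : ‖b - b'‖ ^ 2 ≤ ‖q.1 - q.2‖ ^ 2 := by gcongr
    refine div_le_div_of_nonneg_right ?_ (by positivity)
    nlinarith
  calc _ ≤ 2 * (2 * Real.exp 1) ^ (p - 1) * pairWeight σ μ t ht u v q *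
        (1 / σ ^ 2 * ‖u - v‖ * ‖q.1 - q.2‖ ^ 2) ^ p *
        Real.exp ((p - 1) * ‖q.1 - q.2‖ ^ 2 / (8 * σ ^ 2)) := by
        gcongr
    _ = _ := by
        rw [Real.mul_rpow (x := 1 / σ ^ 2 * ‖u - v‖) (by positivity) (by positivity),
          Real.mul_rpow (x := 1 / σ ^ 2) (by positivity) (by positivity), transportConst, pairCost]
        ring

lemma rpow_one_div_ofReal_mul_rpow {A x : ℝ} (hp : 0 < p) (hA : 0 ≤ A) (hx : 0 ≤ x) :
    ENNReal.ofReal (A * x ^ p) ^ (1 / p) = ENNReal.ofReal (A ^ (1 / p) * x) := by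
  rw [ENNReal.ofReal_rpow_of_nonneg (by positivity) (by positivity),
    Real.mul_rpow hA (by positivity), ← Real.rpow_mul hx, mul_one_div_cancel hp.ne', Real.rpow_one]

lemma wasserstein_smoothedKernel_le_of_bounded (hp : 1 < p) (hσ : 0 < σ) [IsProbabilityMeasure μ]
    {r : ℝ} (hr : ∀ᵐ w ∂μ, ‖w‖ ≤ r) (u v : PathSp d t) :
    wasserstein p (smoothedKernel σ μ t ht u) (smoothedKernel σ μ t ht v) ≤
      ENNReal.ofReal ((transportConst p σ * pairCost p σ ((2 * r) ^ 2)) ^ (1 / p) * ‖u - v‖) := by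
  have hp0 : 0 < p := by linarith
  have hA := transportConst_pos (p := p) hσ
  have hG : 0 ≤ pairCost p σ ((2 * r) ^ 2) := by unfold pairCost; positivity
  rw [← rpow_one_div_ofReal_mul_rpow hp0 (by positivity) (norm_nonneg _)]
  refine (wasserstein_smoothedKernel_le hp hσ u v).trans
    (ENNReal.rpow_le_rpow ?_ (by positivity))
  have hle : ∀ᵐ q ∂μ.prod μ, ENNReal.ofReal (transportConst p σ * ‖u - v‖ ^ p *
      (pairWeight σ μ t ht u v q * pairCost p σ (‖q.1 - q.2‖ ^ 2))) ≤
      ENNReal.ofReal (transportConst p σ * pairCost p σ ((2 * r) ^ 2) * ‖u - v‖ ^ p) *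
        ENNReal.ofReal (pairWeight σ μ t ht u v q) := by
    filter_upwards [Measure.quasiMeasurePreserving_fst.ae hr,
      Measure.quasiMeasurePreserving_snd.ae hr] with q h1 h2
    have hF := pairWeight_pos (σ := σ) (μ := μ) (ht := ht) u v q
    rw [← ENNReal.ofReal_mul (by positivity)]
    refine ENNReal.ofReal_le_ofReal ?_
    have hn : ‖q.1 - q.2‖ ≤ 2 * r := (norm_sub_le _ _).trans (by linarith)
    have hG2 : pairCost p σ (‖q.1 - q.2‖ ^ 2) ≤ pairCost p σ ((2 * r) ^ 2) :=
      pairCost_mono hp (by positivity) (by gcongr)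
    calc _ ≤ transportConst p σ * ‖u - v‖ ^ p *
          (pairWeight σ μ t ht u v q * pairCost p σ ((2 * r) ^ 2)) := by gcongr
      _ = _ := by ring
  refine (lintegral_mono_ae hle).trans_eq ?_
  rw [lintegral_const_mul _ (measurable_pairWeight u v).ennreal_ofReal, lintegral_pairWeight,
    mul_one]

/-! ### Control of the tilted weights by the exponential moment. -/

section Moment

variable {q M : ℝ}

lemma norm_sq_le_exp_moment (hq : 0 < q) (w : PathSp d T) :
    ‖w‖ ^ 2 / (2 * σ ^ 2) ≤ 1 / q * Real.exp (q / (2 * σ ^ 2) * ‖w‖ ^ 2) := by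
  have h := Real.add_one_le_exp (q / (2 * σ ^ 2) * ‖w‖ ^ 2)
  rw [div_mul_eq_mul_div, one_mul, le_div_iff₀ hq]
  have : ‖w‖ ^ 2 / (2 * σ ^ 2) * q = q / (2 * σ ^ 2) * ‖w‖ ^ 2 := by ring
  linarith

lemma integrable_exp_moment {r : ℝ} (h : expMoment r μ ≠ ∞) :
    Integrable (fun w => Real.exp (r * ‖w‖ ^ 2)) μ := by
  refine (lintegral_ofReal_ne_top_iff_integrable (by fun_prop)
    (ae_of_all _ fun w => (Real.exp_pos _).le)).1 h

lemma meanOf_map_initSeg : meanOf (μ.map (initSeg t ht.le)) = ∫ w, initSeg t ht.le w ∂μ := by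
  rw [meanOf, integral_map (measurable_initSeg t ht.le).aemeasurable (by fun_prop)]

/-- Jensen's inequality for exp: the mean of |u - w_{1:t}|² is |u - mean|² plus the variance, and
the variance is at most the second moment, controlled through x + 1 ≤ e^x. -/
lemma exp_le_integral_exp_neg_norm_sub_initSeg (hσ : 0 < σ) (hq : 0 < q) [IsProbabilityMeasure μ]
    (hM : expMoment (q / (2 * σ ^ 2)) μ ≠ ∞) (u : PathSp d t) :
    Real.exp (-‖u - meanOf (μ.map (initSeg t ht.le))‖ ^ 2 / (2 * σ ^ 2) -
      (expMoment (q / (2 * σ ^ 2)) μ).toReal / q) ≤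
      ∫ w, Real.exp (-‖u - initSeg t ht.le w‖ ^ 2 / (2 * σ ^ 2)) ∂μ := by
  have h3 := measurable_initSeg (d := d) t ht.le
  have hY := integrable_exp_moment hM
  have hMY : (expMoment (q / (2 * σ ^ 2)) μ).toReal =
      ∫ w, Real.exp (q / (2 * σ ^ 2) * ‖w‖ ^ 2) ∂μ := by
    rw [integral_eq_lintegral_of_nonneg_ae (ae_of_all _ fun w => (Real.exp_pos _).le)
      (by fun_prop)]
    rfl
  have hsq : Integrable (fun w : PathSp d T => ‖w‖ ^ 2 / (2 * σ ^ 2)) μ := by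
    refine (hY.const_mul (1 / q)).mono' (by fun_prop) (ae_of_all _ fun w => ?_)
    rw [Real.norm_of_nonneg (by positivity)]
    exact norm_sq_le_exp_moment hq w
  have hsq' : Integrable (fun w : PathSp d T => ‖w‖ ^ 2) μ := by
    refine (hsq.mul_const (2 * σ ^ 2)).congr (ae_of_all _ fun w => ?_)
    field_simp
  have hasq : Integrable (fun w : PathSp d T => ‖initSeg t ht.le w‖ ^ 2) μ := by
    refine hsq'.mono' (by fun_prop) (ae_of_all _ fun w => ?_)
    rw [Real.norm_of_nonneg (by positivity)]
    have := norm_initSeg_le t ht w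
    gcongr
  have ha : Integrable (fun w : PathSp d T => initSeg t ht.le w) μ := by
    refine ((integrable_const (1 : ℝ)).add hsq').mono' (by fun_prop) (ae_of_all _ fun w => ?_)
    have := norm_initSeg_le t ht w
    simp only [Pi.add_apply]
    nlinarith [sq_nonneg (‖w‖ - 1)]
  have hexpand : ∀ w, -‖u - initSeg t ht.le w‖ ^ 2 / (2 * σ ^ 2) =
      (-‖u‖ ^ 2 + 2 * inner ℝ u (initSeg t ht.le w) - ‖initSeg t ht.le w‖ ^ 2) / (2 * σ ^ 2) := by
    intro w
    rw [norm_sub_sq_real]; ring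
  have hin : Integrable (fun w => inner ℝ u (initSeg t ht.le w)) μ := ha.const_inner u
  have hlin : Integrable (fun w => -‖u‖ ^ 2 + 2 * inner ℝ u (initSeg t ht.le w)) μ :=
    (integrable_const _).add (hin.const_mul 2)
  have hv : Integrable (fun w => -‖u - initSeg t ht.le w‖ ^ 2 / (2 * σ ^ 2)) μ := by
    simp_rw [hexpand]
    exact (hlin.sub hasq).div_const _
  have hval : ∫ w, -‖u - initSeg t ht.le w‖ ^ 2 / (2 * σ ^ 2) ∂μ =
      (-‖u‖ ^ 2 + 2 * inner ℝ u (meanOf (μ.map (initSeg t ht.le))) -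
        ∫ w, ‖initSeg t ht.le w‖ ^ 2 ∂μ) / (2 * σ ^ 2) := by
    simp_rw [hexpand]
    rw [integral_div, integral_sub hlin hasq, integral_add (integrable_const _) (hin.const_mul 2),
      integral_const_mul, integral_inner ha, meanOf_map_initSeg (ht := ht)]
    simp
  have hbound : (∫ w, ‖initSeg t ht.le w‖ ^ 2 ∂μ) / (2 * σ ^ 2) ≤
      (expMoment (q / (2 * σ ^ 2)) μ).toReal / q := by
    rw [hMY, ← integral_div, ← one_div_mul_eq_div q, ← integral_const_mul]
    refine integral_mono (hasq.div_const _) (hY.const_mul _) fun w => ?_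
    refine le_trans ?_ (norm_sq_le_exp_moment hq w)
    have := norm_initSeg_le t ht w
    gcongr
  have hjensen : Real.exp (∫ w, -‖u - initSeg t ht.le w‖ ^ 2 / (2 * σ ^ 2) ∂μ) ≤
      ∫ w, Real.exp (-‖u - initSeg t ht.le w‖ ^ 2 / (2 * σ ^ 2)) ∂μ :=
    convexOn_exp.map_integral_le Real.continuous_exp.continuousOn isClosed_univ
      (ae_of_all _ fun _ => Set.mem_univ _) hv
      (integrable_exp_neg_norm_sub_initSeg (ht := ht) u)
  refine le_trans (Real.exp_le_exp.2 ?_) hjensen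
  rw [hval, norm_sub_sq_real, sub_div]
  have : -(‖u‖ ^ 2 - 2 * inner ℝ u (meanOf (μ.map (initSeg t ht.le))) +
      ‖meanOf (μ.map (initSeg t ht.le))‖ ^ 2) / (2 * σ ^ 2) ≤
      (-‖u‖ ^ 2 + 2 * inner ℝ u (meanOf (μ.map (initSeg t ht.le)))) / (2 * σ ^ 2) := by
    gcongr
    nlinarith [sq_nonneg ‖meanOf (μ.map (initSeg t ht.le))‖]
  linarith

lemma tiltWeight_le (hσ : 0 < σ) (hq : 0 < q) [IsProbabilityMeasure μ]
    (hM : expMoment (q / (2 * σ ^ 2)) μ ≠ ∞) (u : PathSp d t) (w : PathSp d T) :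
    tiltWeight σ μ t ht u w ≤ Real.exp ((expMoment (q / (2 * σ ^ 2)) μ).toReal / q) *
      Real.exp (‖u - meanOf (μ.map (initSeg t ht.le))‖ ^ 2 / (2 * σ ^ 2)) := by
  have h := exp_le_integral_exp_neg_norm_sub_initSeg (ht := ht) hσ hq hM u
  unfold tiltWeight
  rw [div_le_iff₀ (integral_exp_neg_norm_sub_initSeg_pos (ht := ht) u)]
  refine le_trans ?_ (mul_le_mul_of_nonneg_left h (by positivity))
  rw [← Real.exp_add, ← Real.exp_add]
  refine Real.exp_le_exp.2 ?_
  have : 0 ≤ ‖u - initSeg t ht.le w‖ ^ 2 / (2 * σ ^ 2) := by positivity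
  rw [neg_div, neg_div]
  linarith

/-- Interpolation between total mass 1 and the crude bound f_u ≤ E s: since Y^θ = s^θ (Y/s)^θ ≤ s^θ
(1 + Y/s) and f_u Y/s ≤ E Y, only the power s^θ of the large factor s survives. -/
lemma lintegral_tiltWeight_mul_rpow_le (hσ : 0 < σ) (hq : 0 < q) [IsProbabilityMeasure μ]
    (hM : expMoment (q / (2 * σ ^ 2)) μ ≠ ∞) {θ : ℝ} (h0 : 0 ≤ θ) (h1 : θ ≤ 1) (u : PathSp d t) :
    ∫⁻ w, ENNReal.ofReal (tiltWeight σ μ t ht u w *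
        Real.exp (q / (2 * σ ^ 2) * ‖w‖ ^ 2) ^ θ) ∂μ ≤
      ENNReal.ofReal (Real.exp (‖u - meanOf (μ.map (initSeg t ht.le))‖ ^ 2 / (2 * σ ^ 2)) ^ θ *
        (1 + Real.exp ((expMoment (q / (2 * σ ^ 2)) μ).toReal / q) *
          (expMoment (q / (2 * σ ^ 2)) μ).toReal)) := by
  set s := Real.exp (‖u - meanOf (μ.map (initSeg t ht.le))‖ ^ 2 / (2 * σ ^ 2)) with hs
  set E := Real.exp ((expMoment (q / (2 * σ ^ 2)) μ).toReal / q) with hE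
  have hs0 : 0 < s := Real.exp_pos _
  have hE0 : 0 < E := Real.exp_pos _
  have hpt : ∀ w, ENNReal.ofReal (tiltWeight σ μ t ht u w *
      Real.exp (q / (2 * σ ^ 2) * ‖w‖ ^ 2) ^ θ) ≤
      ENNReal.ofReal (s ^ θ) * (ENNReal.ofReal (tiltWeight σ μ t ht u w) +
        ENNReal.ofReal E * ENNReal.ofReal (Real.exp (q / (2 * σ ^ 2) * ‖w‖ ^ 2))) := by
    intro w
    set Y := Real.exp (q / (2 * σ ^ 2) * ‖w‖ ^ 2) with hY
    have hY0 : 0 < Y := Real.exp_pos _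
    have hf0 := tiltWeight_pos (σ := σ) (μ := μ) (ht := ht) u w
    have hf := tiltWeight_le (ht := ht) hσ hq hM u w
    rw [← ENNReal.ofReal_mul hE0.le, ← ENNReal.ofReal_add hf0.le (by positivity),
      ← ENNReal.ofReal_mul (by positivity)]
    refine ENNReal.ofReal_le_ofReal ?_
    have h2 : (Y / s) ^ θ ≤ 1 + Y / s := by
      have hr : 0 < Y / s := by positivity
      rcases le_total (Y / s) 1 with h | h
      · exact (Real.rpow_le_one hr.le h h0).trans (by linarith)
      · exact (Real.rpow_le_rpow_of_exponent_le h h1).trans (by rw [Real.rpow_one]; linarith)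
    have h3 : Y ^ θ = s ^ θ * (Y / s) ^ θ := by
      rw [← Real.mul_rpow hs0.le (by positivity), mul_div_cancel₀ _ hs0.ne']
    have h4 : tiltWeight σ μ t ht u w * (Y / s) ≤ E * Y := by
      calc _ ≤ (E * s) * (Y / s) := by gcongr
        _ = _ := by field_simp
    rw [h3]
    calc _ = s ^ θ * (tiltWeight σ μ t ht u w * (Y / s) ^ θ) := by ring
      _ ≤ s ^ θ * (tiltWeight σ μ t ht u w * (1 + Y / s)) := by gcongr
      _ ≤ _ := by
        refine mul_le_mul_of_nonneg_left ?_ (by positivity)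
        linarith
  have hmeas := (measurable_tiltWeight (σ := σ) (μ := μ) (ht := ht) u).ennreal_ofReal
  refine (lintegral_mono hpt).trans_eq ?_
  rw [lintegral_const_mul _ (by fun_prop), lintegral_add_left hmeas, lintegral_tiltWeight,
    lintegral_const_mul _ (by fun_prop),
    ENNReal.ofReal_mul (by positivity), ENNReal.ofReal_add zero_le_one (by positivity),
    ENNReal.ofReal_mul hE0.le, ENNReal.ofReal_toReal hM, ENNReal.ofReal_one]
  rfl

/-- At r = 2s the exponential uses the rate (p-1)/(4σ²) in s; the same rate again absorbs the power
(2s)^p, via x^p ≤ e^(px). -/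
lemma pairCost_le (hp : 1 < p) (hσ : 0 < σ) {r s : ℝ} (hr : 0 ≤ r) (hrs : r ≤ 2 * s) :
    pairCost p σ r ≤ (8 * p * σ ^ 2 / (p - 1)) ^ p * Real.exp ((p - 1) / (2 * σ ^ 2) * s) := by
  have hp1 : 0 < p - 1 := by linarith
  have hp0 : 0 < p := by linarith
  have hs : 0 ≤ s := by linarith
  refine (pairCost_mono hp hr hrs).trans ?_
  unfold pairCost
  have h1 : (2 * s) ^ p ≤ (8 * p * σ ^ 2 / (p - 1)) ^ p * Real.exp ((p - 1) / (4 * σ ^ 2) * s) := by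
    have e : 2 * s = (8 * p * σ ^ 2 / (p - 1)) * ((p - 1) / (4 * σ ^ 2) * s / p) := by
      field_simp; ring
    rw [e, Real.mul_rpow (by positivity) (by positivity)]
    refine mul_le_mul_of_nonneg_left ?_ (by positivity)
    calc _ ≤ Real.exp ((p - 1) / (4 * σ ^ 2) * s / p) ^ p := by
          gcongr
          linarith [Real.add_one_le_exp ((p - 1) / (4 * σ ^ 2) * s / p)]
      _ = _ := by rw [← Real.exp_mul]; congr 1; field_simp
  calc _ ≤ (8 * p * σ ^ 2 / (p - 1)) ^ p * Real.exp ((p - 1) / (4 * σ ^ 2) * s) *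
        Real.exp ((p - 1) * (2 * s) / (8 * σ ^ 2)) := by gcongr
    _ = _ := by
      rw [mul_assoc, ← Real.exp_add]
      congr 2
      field_simp
      ring

lemma wasserstein_smoothedKernel_le_of_expMoment (hp : 1 < p) (hσ : 0 < σ) (hq : p - 1 ≤ q)
    [IsProbabilityMeasure μ] (hM : expMoment (q / (2 * σ ^ 2)) μ ≠ ∞) {β : ℝ}
    (hβ : (p - 1) / q / p ≤ β) (u v : PathSp d t) :
    wasserstein p (smoothedKernel σ μ t ht u) (smoothedKernel σ μ t ht v) ≤
      ENNReal.ofReal ((transportConst p σ * (8 * p * σ ^ 2 / (p - 1)) ^ p *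
        (1 + Real.exp ((expMoment (q / (2 * σ ^ 2)) μ).toReal / q) *
          (expMoment (q / (2 * σ ^ 2)) μ).toReal) ^ 2) ^ (1 / p) *
        Real.exp (β / σ ^ 2 * (max ‖u - meanOf (μ.map (initSeg t ht.le))‖
          ‖v - meanOf (μ.map (initSeg t ht.le))‖) ^ 2) * ‖u - v‖) := by
  have hp0 : 0 < p := by linarith
  have hp1 : 0 < p - 1 := by linarith
  have hq0 : 0 < q := by linarith
  have hA := transportConst_pos (p := p) hσ
  set m := meanOf (μ.map (initSeg t ht.le))
  set R := max ‖u - m‖ ‖v - m‖ with hR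
  set B := 1 + Real.exp ((expMoment (q / (2 * σ ^ 2)) μ).toReal / q) *
          (expMoment (q / (2 * σ ^ 2)) μ).toReal with hB
  have hB0 : 0 < B := by
    have := (Real.exp_pos ((expMoment (q / (2 * σ ^ 2)) μ).toReal / q)).le
    have := (expMoment (q / (2 * σ ^ 2)) μ).toReal_nonneg
    positivity
  -- Chosen so that exp(q|w|²/(2σ²))^θ is exactly the factor exp((p-1)|w|²/(2σ²)) left by
  -- `pairCost_le` for each path.
  set θ := (p - 1) / q with hθ
  have hθ0 : 0 ≤ θ := by positivity
  have hθ1 : θ ≤ 1 := (div_le_one hq0).2 hq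
  set C₁ := (8 * p * σ ^ 2 / (p - 1)) ^ p with hC₁
  have hC₁0 : 0 < C₁ := by positivity
  have hYθ : ∀ w : PathSp d T, Real.exp (q / (2 * σ ^ 2) * ‖w‖ ^ 2) ^ θ =
      Real.exp ((p - 1) / (2 * σ ^ 2) * ‖w‖ ^ 2) := by
    intro w
    rw [← Real.exp_mul, hθ]
    congr 1
    field_simp
  have hpt : ∀ z : PathSp d T × PathSp d T, ENNReal.ofReal (transportConst p σ * ‖u - v‖ ^ p *
      (pairWeight σ μ t ht u v z * pairCost p σ (‖z.1 - z.2‖ ^ 2))) ≤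
      ENNReal.ofReal (transportConst p σ * C₁ * ‖u - v‖ ^ p) *
        (ENNReal.ofReal (tiltWeight σ μ t ht u z.1 *
          Real.exp (q / (2 * σ ^ 2) * ‖z.1‖ ^ 2) ^ θ) *
        ENNReal.ofReal (tiltWeight σ μ t ht v z.2 *
          Real.exp (q / (2 * σ ^ 2) * ‖z.2‖ ^ 2) ^ θ)) := by
    intro z
    have hu := tiltWeight_pos (σ := σ) (μ := μ) (ht := ht) u z.1
    have hv := tiltWeight_pos (σ := σ) (μ := μ) (ht := ht) v z.2
    rw [← ENNReal.ofReal_mul (by positivity), ← ENNReal.ofReal_mul (by positivity)]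
    refine ENNReal.ofReal_le_ofReal ?_
    have hr : ‖z.1 - z.2‖ ^ 2 ≤ 2 * (‖z.1‖ ^ 2 + ‖z.2‖ ^ 2) := by
      have := norm_sub_le z.1 z.2
      nlinarith [norm_nonneg (z.1 - z.2), sq_nonneg (‖z.1‖ - ‖z.2‖)]
    have hG := pairCost_le hp hσ (by positivity) hr
    rw [hYθ, hYθ, pairWeight]
    calc _ ≤ transportConst p σ * ‖u - v‖ ^ p *
          (tiltWeight σ μ t ht u z.1 * tiltWeight σ μ t ht v z.2 *
          (C₁ * Real.exp ((p - 1) / (2 * σ ^ 2) * (‖z.1‖ ^ 2 + ‖z.2‖ ^ 2)))) := by gcongr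
      _ = _ := by rw [mul_add, Real.exp_add]; ring
  have hmeas : ∀ u : PathSp d t, Measurable fun w : PathSp d T =>
      ENNReal.ofReal (tiltWeight σ μ t ht u w * Real.exp (q / (2 * σ ^ 2) * ‖w‖ ^ 2) ^ θ) := by
    intro u
    have := measurable_tiltWeight (σ := σ) (μ := μ) (ht := ht) u
    fun_prop
  have hexp : ∀ w : PathSp d t, ‖w - m‖ ≤ R →
      Real.exp (‖w - m‖ ^ 2 / (2 * σ ^ 2)) ^ θ ≤ Real.exp (θ * R ^ 2 / (2 * σ ^ 2)) := by
    intro w hw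
    rw [← Real.exp_mul]
    refine Real.exp_le_exp.2 ?_
    rw [div_mul_eq_mul_div, mul_comm]
    gcongr
  have hint : ∫⁻ z, ENNReal.ofReal (transportConst p σ * ‖u - v‖ ^ p *
      (pairWeight σ μ t ht u v z * pairCost p σ (‖z.1 - z.2‖ ^ 2))) ∂μ.prod μ ≤
      ENNReal.ofReal ((transportConst p σ * C₁ * B ^ 2) *
        (Real.exp (β / σ ^ 2 * R ^ 2) * ‖u - v‖) ^ p) := by
    refine (lintegral_mono hpt).trans ?_
    rw [lintegral_const_mul' _ _ ENNReal.ofReal_ne_top,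
      lintegral_prod_mul (hmeas u).aemeasurable (hmeas v).aemeasurable]
    refine (mul_le_mul_right (mul_le_mul' (lintegral_tiltWeight_mul_rpow_le hσ hq0 hM hθ0 hθ1 u)
      (lintegral_tiltWeight_mul_rpow_le hσ hq0 hM hθ0 hθ1 v)) _).trans ?_
    rw [← ENNReal.ofReal_mul (by positivity), ← ENNReal.ofReal_mul (by positivity)]
    refine ENNReal.ofReal_le_ofReal ?_
    calc _ ≤ transportConst p σ * C₁ * ‖u - v‖ ^ p *
          ((Real.exp (θ * R ^ 2 / (2 * σ ^ 2)) * B) * (Real.exp (θ * R ^ 2 / (2 * σ ^ 2)) * B)) := by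
          have h1 := hexp u (le_max_left _ _)
          have h2 := hexp v (le_max_right _ _)
          gcongr
      _ = transportConst p σ * C₁ * B ^ 2 * (Real.exp (θ * R ^ 2 / σ ^ 2) * ‖u - v‖ ^ p) := by
          have : Real.exp (θ * R ^ 2 / σ ^ 2) =
              Real.exp (θ * R ^ 2 / (2 * σ ^ 2)) * Real.exp (θ * R ^ 2 / (2 * σ ^ 2)) := by
            rw [← Real.exp_add]; congr 1; field_simp; ring
          rw [this]; ring
      _ ≤ _ := by
          rw [Real.mul_rpow (Real.exp_pos _).le (norm_nonneg _), ← Real.exp_mul]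
          gcongr
          have : θ ≤ β * p := (div_le_iff₀ hp0).1 hβ
          calc θ * R ^ 2 / σ ^ 2 ≤ β * p * R ^ 2 / σ ^ 2 := by gcongr
            _ = _ := by ring
  refine (wasserstein_smoothedKernel_le hp hσ u v).trans ?_
  refine (ENNReal.rpow_le_rpow hint (by positivity)).trans_eq ?_
  rw [rpow_one_div_ofReal_mul_rpow hp0 (by positivity) (by positivity), ← mul_assoc]

end Moment

end Main

/-! ### Assembly of the three claims. -/

theorem proposition4 (d : ℕ) (hd : 1 ≤ d) (p : ℝ) (hp : 1 < p) (σ : ℝ) (hσ : 0 < σ) :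
    -- the kernels are the regular conditional laws of `X_{t+1}` given `X_{1:t}`
    (∀ (T : ℕ), 2 ≤ T → ∀ (μ : Measure (PathSp d T)) [IsProbabilityMeasure μ]
      (t : ℕ) (ht : t < T), 1 ≤ t →
      ∃ κ : Kernel (PathSp d t) (St d), IsMarkovKernel κ ∧
        (∀ u, κ u = smoothedKernel σ μ t ht u) ∧
        ((smoothed σ μ).map fun x => (initSeg t ht.le x, nextState t ht x)).IsCondKernel κ) ∧
    -- subgaussian measures: locally Lipschitz kernels
    (∀ (β q : ℝ), 0 < β → β < 1 / p.conjExponent → 2 * (p - 1) / β < q →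
      ∀ M : ℝ≥0∞, M < ∞ →
      ∃ C : ℝ, 0 < C ∧
        ∀ (T : ℕ), 2 ≤ T → ∀ (μ : Measure (PathSp d T)) [IsProbabilityMeasure μ],
          expMoment (q / (2 * σ ^ 2)) μ = M →
          ∀ (x y : PathSp d T) (t : ℕ) (ht : t < T), 1 ≤ t →
            wasserstein p (smoothedKernel σ μ t ht (initSeg t ht.le x))
                (smoothedKernel σ μ t ht (initSeg t ht.le y)) ≤
              ENNReal.ofReal (C *
                Real.exp (β / σ ^ 2 *
                  (max ‖initSeg t ht.le x - meanOf (μ.map (initSeg t ht.le))‖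
                    ‖initSeg t ht.le y - meanOf (μ.map (initSeg t ht.le))‖) ^ 2) *
                ‖initSeg t ht.le x - initSeg t ht.le y‖)) ∧
    -- compactly supported measures: globally Lipschitz kernels
    (∀ (T : ℕ), 2 ≤ T → ∀ S : Set (PathSp d T), IsCompact S →
      ∃ C : ℝ, 0 < C ∧
        ∀ (μ : Measure (PathSp d T)) [IsProbabilityMeasure μ], μ.support = S →
          ∀ (x y : PathSp d T) (t : ℕ) (ht : t < T), 1 ≤ t →
            wasserstein p (smoothedKernel σ μ t ht (initSeg t ht.le x))
                (smoothedKernel σ μ t ht (initSeg t ht.le y)) ≤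
              ENNReal.ofReal (C * ‖initSeg t ht.le x - initSeg t ht.le y‖)) := by
  refine ⟨?_, ?_, ?_⟩
  · intro T _ μ _ t ht _
    exact ⟨condKernelSmoothed σ μ t ht, isMarkovKernel_condKernelSmoothed hσ,
      condKernelSmoothed_apply, isCondKernel_condKernelSmoothed hσ⟩
  · intro β q hβ hβ' hq M hM
    have hp1 : 0 < p - 1 := by linarith
    have hqβ : 2 * (p - 1) < q * β := (div_lt_iff₀ hβ).1 hq
    have hq0 : 0 < q := lt_trans (by positivity) hq
    -- With β < 1 the condition on q forces q > 2(p-1), hence θ ≤ 1, as the interpolation requires.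
    have hβ1 : β < 1 := hβ'.trans_le (by
      rw [Real.conjExponent, one_div_div, div_le_one (by linarith)]; linarith)
    have hqp : p - 1 ≤ q := by nlinarith
    have hβp : (p - 1) / q / p ≤ β := by
      rw [div_div, div_le_iff₀ (by positivity)]
      nlinarith
    have hA := transportConst_pos (p := p) hσ
    refine ⟨(transportConst p σ * (8 * p * σ ^ 2 / (p - 1)) ^ p *
        (1 + Real.exp (M.toReal / q) * M.toReal) ^ 2) ^ (1 / p), ?_, ?_⟩
    · have : 0 ≤ M.toReal := M.toReal_nonneg
      positivity
    · intro T _ μ _ hμ x y t ht _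
      subst hμ
      exact wasserstein_smoothedKernel_le_of_expMoment hp hσ hqp hM.ne hβp _ _
  · intro T _ S hS
    obtain ⟨r, hr⟩ := hS.isBounded.exists_norm_le
    have hA := transportConst_pos (p := p) hσ
    -- The summand 1 keeps the constant positive when r = 0, where the pair cost vanishes.
    refine ⟨(transportConst p σ * pairCost p σ ((2 * r) ^ 2)) ^ (1 / p) + 1, ?_, ?_⟩
    · have : 0 ≤ pairCost p σ ((2 * r) ^ 2) := by unfold pairCost; positivity
      positivity
    · intro μ _ hμ x y t ht _
      have hae : ∀ᵐ w ∂μ, ‖w‖ ≤ r := by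
        filter_upwards [Measure.support_mem_ae (μ := μ)] with w hw using hr w (hμ ▸ hw)
      refine (wasserstein_smoothedKernel_le_of_bounded hp hσ hae _ _).trans
        (ENNReal.ofReal_le_ofReal ?_)
      gcongr
      linarith
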